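/- Let $X$ be a locally compact Hausdorff space with a finite open cover $X=U_1\cup\cdots\cup U_r$, $r\ge 1$. For $A\subseteq\{1,\dots,r\}$ put $U_A=\bigcup_{k\in A}U_k$, let $j_A:U_A\to X$ be the inclusion, and let $\iota:U_1\cap\cdots\cap U_r\to X$ be the inclusion of the intersection. For each $A$ let $I_A^\bullet$ be an injective resolution of the constant sheaf $\mathbb{C}_{U_A}$, with chain maps $\rho_{A,B}: j_{A*}I_A^\bullet\to j_{B*}I_B^\bullet$ for $B\subseteq A$ that are functorial ($\rho_{A,A}=\mathrm{id}$, $\rho_{B,C}\circ\rho_{A,B}=\rho_{A,C}$) and compatible, via the augmentations $\mathbb{C}_{U_A}\to I_A^0$, with the restriction maps $j_{A*}\mathbb{C}_{U_A}\to j_{B*}\mathbb{C}_{U_B}$ (for example, the restrictions $I^\bullet|_{U_A}$ of one injective resolution $I^\bullet$ of $\mathbb{C}_X$). Write $Rj_{A*}\mathbb{C}_{U_A}$ for the complex of sheaves $j_{A*}I_A^\bullet$ and $\overline J$ for the complement of $J$ in $\{1,\dots,r\}$. Consider the double complex of sheaves of complex vector spaces on $X$ $$Rj_{\{1,\dots,r\}*}\mathbb{C}_{X}\to\bigoplus_{\#J=1}Rj_{\overline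 J*}\mathbb{C}_{U_{\overline J}}\to\bigoplus_{\#J=2}Rj_{\overline J*}\mathbb{C}_{U_{\overline J}}\to\cdots\to\bigoplus_{\#J=r-1}Rj_{\overline J*}\mathbb{C}_{U_{\overline J}},$$ with first term in horizontal degree $0$, in which the component of the differential from $J$ to $J\cup\{i\}$ ($i\notin J$) is $(-1)^{\#\{j\in J:\,j<i\}}\rho_{\overline J,\overline{J\cup\{i\}}}$ and the other components are $0$. Then for every injective resolution $K^\bullet$ of the constant sheaf on $U_1\cap\cdots\cap U_r$, with $R\iota_*\mathbb{C}_{U_1\cap\cdots\cap U_r}=\iota_*K^\bullet$, the total complex of this double complex admits a chain map to $R\iota_*\mathbb{C}_{U_1\cap\cdots\cap U_r}[-(r-1)]$ that is a quasi-isomorphism. -/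

import Mathlib

open CategoryTheory CategoryTheory.Limits TopologicalSpace TopCat

universe u

noncomputable section

namespace CechComplement

/-- The category of complex vector spaces in the universe `u` (the field `ℂ` has to be lifted to
the universe of the spaces). -/
abbrev CVect := ModuleCat.{u} (ULift.{u} ℂ)

/-- Sheaves of complex vector spaces on a topological space. -/
abbrev Sh (Y : TopCat.{u}) := TopCat.Sheaf CVect.{u} Y

/-- The constant sheaf `ℂ_Y`: the sheafification of the constant presheaf with value `ℂ`. -/
def constSheaf (Y : TopCat.{u}) : Sh Y :=
  (constantSheaf (Opens.grothendieckTopology Y) CVect.{u}).obj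
    (ModuleCat.of (ULift.{u} ℂ) (ULift.{u} ℂ))

/-- The direct image functor `f_*` on sheaves of complex vector spaces. -/
abbrev push {Y Z : TopCat.{u}} (f : Y ⟶ Z) : Sh Y ⥤ Sh Z :=
  TopCat.Sheaf.pushforward CVect.{u} f

instance {Y Z : TopCat.{u}} (f : Y ⟶ Z) : (push f).Additive where

/-- The direct image functor applied degreewise to cochain complexes of sheaves. -/
abbrev pushComplex {Y Z : TopCat.{u}} (f : Y ⟶ Z) :
    CochainComplex (Sh Y) ℤ ⥤ CochainComplex (Sh Z) ℤ :=
  (push f).mapHomologicalComplex (ComplexShape.up ℤ)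

/-- For `f : Y ⟶ Z`, the pullback of locally constant functions `ℂ_Z ⟶ f_* ℂ_Y`: the morphism out
of the constant sheaf `ℂ_Z` that is given, on global sections, by the canonical map
`ℂ ⟶ Γ(Y, ℂ_Y) = Γ(Z, f_* ℂ_Y)`. -/
def constToPush {Y Z : TopCat.{u}} (f : Y ⟶ Z) :
    constSheaf Z ⟶ (push f).obj (constSheaf Y) :=
  ((constantSheafAdj (Opens.grothendieckTopology Z) CVect.{u}
      (isTerminalTop (α := Opens Z))).homEquiv _ _).symm
    ((constantSheafAdj (Opens.grothendieckTopology Y) CVect.{u}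
      (isTerminalTop (α := Opens Y))).unit.app (ModuleCat.of (ULift.{u} ℂ) (ULift.{u} ℂ)))

variable {X : TopCat.{u}}

instance : HasFiniteBiproducts (CochainComplex (Sh X) ℤ) := Abelian.hasFiniteBiproducts

/-- For opens `V ⊆ W` of `X` with inclusions `j_V`, `j_W`, the restriction morphism
`j_{W*} ℂ_W ⟶ j_{V*} ℂ_V`. -/
def constRestrict {V W : Opens X} (h : V ≤ W) :
    (push W.inclusion').obj (constSheaf ((Opens.toTopCat X).obj W)) ⟶
      (push V.inclusion').obj (constSheaf ((Opens.toTopCat X).obj V)) :=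
  (push W.inclusion').map (constToPush ((Opens.toTopCat X).map (homOfLE h)))

/-- `Rj_{W*} ℂ_W` as a complex of sheaves: the direct image along the inclusion `j_W` of a chosen
injective resolution of the constant sheaf `ℂ_W`. -/
abbrev derivedPush {W : Opens X}
    (R : InjectiveResolution (constSheaf ((Opens.toTopCat X).obj W))) :
    CochainComplex (Sh X) ℤ :=
  (pushComplex W.inclusion').obj R.cochainComplex

/-- The direct image `j_{W*} ℂ_W ⟶ j_{W*} I^0` of the augmentation `ℂ_W ⟶ I^0` of an injective
resolution `I` of `ℂ_W`. -/
def augmentation {W : Opens X}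
    (R : InjectiveResolution (constSheaf ((Opens.toTopCat X).obj W))) :
    (push W.inclusion').obj (constSheaf ((Opens.toTopCat X).obj W)) ⟶ (derivedPush R).X 0 :=
  (push W.inclusion').map
    ((HomologicalComplex.singleObjXSelf (ComplexShape.up ℤ) 0 _).inv ≫ R.ι'.f 0)

variable {r : ℕ}

/-- The open set `U_A = ⋃_{k ∈ A} U_k`. -/
def unionOpen (U : Fin r → Opens X) (A : Finset (Fin r)) : Opens X := ⨆ k ∈ A, U k

/-- The open set `U_1 ∩ ⋯ ∩ U_r`. -/
def deepest (U : Fin r → Opens X) : Opens X := ⨅ k, U k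

lemma unionOpen_mono (U : Fin r → Opens X) {A B : Finset (Fin r)} (h : B ⊆ A) :
    unionOpen U B ≤ unionOpen U A :=
  biSup_mono fun _ hk => h hk

/-- Injective resolutions `I_A` of the constant sheaves `ℂ_{U_A}`, with restriction maps
`j_{A*} I_A ⟶ j_{B*} I_B` for `B ⊆ A` that are functorial and that cover the restriction maps
`j_{A*} ℂ_{U_A} ⟶ j_{B*} ℂ_{U_B}` of the constant sheaves. This is a choice of complexes that
represent the `Rj_{A*} ℂ_{U_A}` for which the restriction maps commute on the nose, so that they form
a complex of complexes; the restrictions to the `U_A` of one injective resolution of `ℂ_X`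
are an example. -/
structure ResolutionSystem (U : Fin r → Opens X) where
  res (A : Finset (Fin r)) :
    InjectiveResolution (constSheaf ((Opens.toTopCat X).obj (unionOpen U A)))
  restrict {A B : Finset (Fin r)} (h : B ⊆ A) : derivedPush (res A) ⟶ derivedPush (res B)
  restrict_self (A : Finset (Fin r)) : restrict (Finset.Subset.refl A) = 𝟙 _
  restrict_comp {A B C : Finset (Fin r)} (h : B ⊆ A) (h' : C ⊆ B) :
    restrict h ≫ restrict h' = restrict (h'.trans h)
  augmentation_restrict {A B : Finset (Fin r)} (h : B ⊆ A) :
    augmentation (res A) ≫ (restrict h).f 0 =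
      constRestrict (unionOpen_mono U h) ≫ augmentation (res B)

/-- The index set of the `p`-th term: the proper subsets `J` of the set of indices with
`p` elements. -/
abbrev Idx (r : ℕ) (p : ℤ) :=
  {J : Finset (Fin r) // (J.card : ℤ) = p ∧ J ≠ Finset.univ}

/-- The number of pairs `j < i` with `j ∈ J` and `i ∈ K \ J`. If `K = J ∪ {i}`, this is the position
(counted from `0`) of `i` in `K`. -/
def inversions (J K : Finset (Fin r)) : ℕ :=
  ((J ×ˢ (K \ J)).filter fun x => x.1 < x.2).card

lemma union_sdiff_insert {J : Finset (Fin r)} {a b : Fin r} (hab : a ≠ b) :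
    J ∪ (insert b (insert a J) \ insert a J) = insert b J := by
  ext x
  simp only [Finset.mem_union, Finset.mem_sdiff, Finset.mem_insert]
  grind

lemma union_sdiff_union_sdiff {J K L : Finset (Fin r)} (h : J ⊆ K) (h' : K ⊆ L) :
    J ∪ (L \ (J ∪ (L \ K))) = K := by
  ext x
  have h₁ := @h x
  have h₂ := @h' x
  simp only [Finset.mem_union, Finset.mem_sdiff]
  tauto

lemma inversions_insert {J : Finset (Fin r)} {a : Fin r} (ha : a ∉ J) :
    inversions J (insert a J) = (J.filter (· < a)).card := by
  have h : insert a J \ J = {a} := by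
    ext x; simp only [Finset.mem_sdiff, Finset.mem_insert, Finset.mem_singleton]; grind
  rw [inversions, h]
  refine Finset.card_bij (fun x _ => x.1) ?_ ?_ ?_
  · rintro ⟨x, y⟩ hx
    simp only [Finset.mem_filter, Finset.mem_product, Finset.mem_singleton] at hx ⊢
    grind
  · rintro ⟨x, y⟩ hx ⟨x', y'⟩ hx' h
    simp only [Finset.mem_filter, Finset.mem_product, Finset.mem_singleton] at hx hx' h
    grind
  · intro x hx
    refine ⟨(x, a), ?_, rfl⟩
    simp only [Finset.mem_filter, Finset.mem_product, Finset.mem_singleton] at hx ⊢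
    grind

lemma sign_swap {J : Finset (Fin r)} {a b : Fin r} (ha : a ∉ J) (hb : b ∉ J) (hab : a ≠ b) :
    (-1 : ℤ) ^ inversions J (insert a J) *
        (-1) ^ inversions (insert a J) (insert b (insert a J)) +
      (-1) ^ inversions J (insert b J) *
        (-1) ^ inversions (insert b J) (insert b (insert a J)) = 0 := by
  have hb' : b ∉ insert a J := by grind
  have ha' : a ∉ insert b J := by grind
  have key : inversions (insert b J) (insert b (insert a J)) =
      ((insert b J).filter (· < a)).card := by
    rw [Finset.insert_comm, inversions_insert ha']
  rw [inversions_insert ha, inversions_insert hb, inversions_insert hb', key,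
    Finset.filter_insert, Finset.filter_insert]
  rcases lt_or_gt_of_ne hab with h | h
  · rw [if_pos h, if_neg (not_lt.mpr h.le), Finset.card_insert_of_notMem (by grind)]
    ring
  · rw [if_neg (not_lt.mpr h.le), if_pos h, Finset.card_insert_of_notMem (by grind)]
    ring

namespace ResolutionSystem

variable {U : Fin r → Opens X} (S : ResolutionSystem U)

/-- The summand indexed by `J`: the complex `Rj_{Jᶜ*} ℂ_{U_{Jᶜ}}`, where `Jᶜ` is the
complement of `J`. -/
abbrev summand (J : Finset (Fin r)) : CochainComplex (Sh X) ℤ := derivedPush (S.res Jᶜ)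

/-- The component of the differential from the summand `J` to the summand `K`: the restriction map
with the sign `(-1)^{position of i in K}` if `K = J ∪ {i}`, and `0` if `J` is not contained
in `K`. -/
def entry (J K : Finset (Fin r)) : S.summand J ⟶ S.summand K :=
  if h : J ⊆ K then
    (-1 : ℤ) ^ inversions J K • S.restrict (Finset.compl_subset_compl.mpr h)
  else 0

lemma entry_comp_entry {J K L : Finset (Fin r)} (hJK : J ⊆ K) (hKL : K ⊆ L) :
    S.entry J K ≫ S.entry K L =
      ((-1 : ℤ) ^ inversions J K * (-1) ^ inversions K L) •
        S.restrict (Finset.compl_subset_compl.mpr (hJK.trans hKL)) := by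
  rw [entry, entry, dif_pos hJK, dif_pos hKL, Preadditive.zsmul_comp, Preadditive.comp_zsmul,
    S.restrict_comp, smul_smul]

lemma entry_comp_entry_eq_zero {J K L : Finset (Fin r)} (h : ¬(J ⊆ K ∧ K ⊆ L)) :
    S.entry J K ≫ S.entry K L = 0 := by
  by_cases h₁ : J ⊆ K
  · have h₂ : ¬ K ⊆ L := fun h₂ => h ⟨h₁, h₂⟩
    rw [entry, entry, dif_neg h₂, comp_zero]
  · rw [entry, dif_neg h₁, zero_comp]

lemma sum_entry_comp_entry {p q s : ℤ} (hpq : p + 1 = q) (hqs : q + 1 = s)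
    (J : Idx r p) (L : Idx r s) :
    ∑ K : Idx r q, S.entry J.1 K.1 ≫ S.entry K.1 L.1 = 0 := by
  obtain ⟨J, hJ, hJ'⟩ := J
  obtain ⟨L, hL, hL'⟩ := L
  have pair {K : Finset (Fin r)} (hK : (K.card : ℤ) = q) (h₁ : J ⊆ K) (h₂ : K ⊆ L) :
      ∃ a b, a ∉ J ∧ b ∉ J ∧ a ≠ b ∧ K = insert a J ∧ L = insert b (insert a J) := by
    obtain ⟨a, ha, rfl⟩ := Finset.exists_eq_insert_iff.mpr ⟨h₁, by omega⟩
    obtain ⟨b, hb, rfl⟩ := Finset.exists_eq_insert_iff.mpr ⟨h₂, by omega⟩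
    exact ⟨a, b, ha, by grind, by grind, rfl, rfl⟩
  have other {K : Finset (Fin r)} (hK : (K.card : ℤ) = q) (h₁ : J ⊆ K) (h₂ : K ⊆ L) :
      ((J ∪ (L \ K)).card : ℤ) = q ∧ J ∪ (L \ K) ≠ Finset.univ := by
    obtain ⟨a, b, ha, hb, hab, rfl, rfl⟩ := pair hK h₁ h₂
    rw [union_sdiff_insert hab]
    refine ⟨?_, fun h' => hL' ?_⟩
    · rw [Finset.card_insert_of_notMem hb]
      rw [Finset.card_insert_of_notMem ha] at hK
      exact hK
    · grind
  obtain ⟨g, hg, hg'⟩ : ∃ g : Idx r q → Idx r q,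
      (∀ K, J ⊆ K.1 ∧ K.1 ⊆ L → (g K).1 = J ∪ (L \ K.1)) ∧
        ∀ K, ¬(J ⊆ K.1 ∧ K.1 ⊆ L) → g K = K := by
    classical
    exact ⟨fun K => if h : J ⊆ K.1 ∧ K.1 ⊆ L then ⟨J ∪ (L \ K.1), other K.2.1 h.1 h.2⟩ else K,
      fun K h => by simp only [dif_pos h], fun K h => dif_neg h⟩
  refine Finset.sum_involution (fun K _ => g K) ?_ ?_ (fun _ _ => Finset.mem_univ _) ?_
  · intro K _
    by_cases h : J ⊆ K.1 ∧ K.1 ⊆ L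
    · rw [hg K h]
      obtain ⟨K, hK, hK'⟩ := K
      obtain ⟨a, b, ha, hb, hab, rfl, rfl⟩ := pair hK h.1 h.2
      dsimp only at h ⊢
      rw [union_sdiff_insert hab, S.entry_comp_entry h.1 h.2,
        S.entry_comp_entry (Finset.subset_insert b J)
          (Finset.insert_subset_insert b (Finset.subset_insert a J)), ← add_smul,
        sign_swap ha hb hab, zero_smul]
    · rw [hg' K h, S.entry_comp_entry_eq_zero h, add_zero]
  · intro K _ hne h'
    have h : J ⊆ K.1 ∧ K.1 ⊆ L := by
      by_contra h
      exact hne (S.entry_comp_entry_eq_zero h)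
    have h'' := congrArg Subtype.val h'
    rw [hg K h] at h''
    obtain ⟨K, hK, hK'⟩ := K
    obtain ⟨a, b, ha, hb, hab, rfl, rfl⟩ := pair hK h.1 h.2
    dsimp only at h''
    rw [union_sdiff_insert hab] at h''
    rcases Finset.mem_insert.mp (h'' ▸ Finset.mem_insert_self b J) with hb' | hb'
    · exact hab hb'.symm
    · exact hb hb'
  · intro K _
    by_cases h : J ⊆ K.1 ∧ K.1 ⊆ L
    · apply Subtype.ext
      rw [hg (g K), hg K h, union_sdiff_union_sdiff h.1 h.2]
      rw [hg K h]
      exact ⟨Finset.subset_union_left,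
        Finset.union_subset (h.1.trans h.2) Finset.sdiff_subset⟩
    · rw [hg' K h, hg' K h]

/-- The `p`-th term `⨁_{#J = p} Rj_{Jᶜ*} ℂ_{U_{Jᶜ}}`. -/
abbrev term (p : ℤ) : CochainComplex (Sh X) ℤ := ⨁ fun J : Idx r p => S.summand J.1

/-- The differential from the `p`-th to the `q`-th term (nonzero only for `q = p + 1`). -/
def diff (p q : ℤ) : S.term p ⟶ S.term q :=
  if p + 1 = q then
    biproduct.matrix fun (J : Idx r p) (K : Idx r q) => S.entry J.1 K.1
  else 0

lemma diff_comp_diff {p q s : ℤ} (hpq : p + 1 = q) (hqs : q + 1 = s) :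
    S.diff p q ≫ S.diff q s = 0 := by
  rw [diff, diff, if_pos hpq, if_pos hqs]
  apply biproduct.hom_ext'
  intro J
  apply biproduct.hom_ext
  intro L
  simp only [biproduct.ι_matrix_assoc, biproduct.matrix_π, biproduct.lift_desc, Category.assoc,
    comp_zero, zero_comp]
  exact S.sum_entry_comp_entry hpq hqs J L

/-- The double complex `(1,…,r) ⟶ ∑ (ī) ⟶ ∑ (i,j)‾ ⟶ ⋯ ⟶ ∑ (i)`, as a complex of complexes of
sheaves on `X`, with the term `(1,…,r)` in the horizontal degree `0`. -/
def doubleComplex :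
    HomologicalComplex₂ (Sh X) (ComplexShape.up ℤ) (ComplexShape.up ℤ) where
  X := S.term
  d := S.diff
  shape _ _ h := if_neg h
  d_comp_d' _ _ _ h h' := S.diff_comp_diff h h'

instance : S.doubleComplex.HasTotal (ComplexShape.up ℤ) := fun _ => inferInstance

/-- The total complex of the double complex. -/
abbrev total : CochainComplex (Sh X) ℤ := S.doubleComplex.total (ComplexShape.up ℤ)

end ResolutionSystem

end CechComplement

end

/-!
The direct image of the resolution over `U_1 ∪ ⋯ ∪ U_r = X` is a bounded below complex `I` of
injective sheaves that resolves the constant sheaf `ℂ_X`. The restriction `j^* I` to an open subspace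
is again a complex of injective sheaves (`injective_restr`) and resolves the constant sheaf there.
Hence, for every `A`, the morphism `j_A^* I ⟶ I_A` adjoint to the restriction map `ρ` is a
quasi-isomorphism between K-injective complexes (`quasiIso_compare`), and its direct image is a
quasi-isomorphism `j_{A*} j_A^* I ⟶ j_{A*} I_A`. These morphisms are compatible with the restriction
maps (`map_comp_toSummand`). So the double complex receives a columnwise quasi-isomorphism from the
double complex with the summands `j_{A*} j_A^* I` (`toDoubleComplex`), and a columnwise
quasi-isomorphism of first quadrant double complexes induces a quasi-isomorphism of total complexes
(`quasiIso_total_map`).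

The summands of the new double complex are the vertices `J ≠ {1, …, r}` of a cube of sheaves
`(j_J)_* j_J^* F`, for `F = I^q`, where `j_J` is the inclusion of the union of the `U_k` with `k ∉ J`.
The last vertex of the cube is filled with the sheaf of the intersection `U_1 ∩ ⋯ ∩ U_r`. The whole
cube is contractible (`nonempty_locCubeContraction`): the injective sheaf `F` is a direct summand of
a sheaf of discontinuous sections, that is, of families of vectors in given vector spaces indexed by
the points, and a contraction may be defined there for every point `x` separately. If `x ∉ U_k` for
some `k`, then the faces with and without `k` have the same fibre over `x` and cancel; if
`x` lies in all `U_k`, then all vertices have the same fibre, including the last one, and any index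
`k` can be used. So the augmented rows are split exact, and the total complex is quasi-isomorphic to
the last vertex shifted by `-(r - 1)` (`quasiIso_totalToShift_cubeAugmentation`). The last vertex is
the direct image of the restriction of `I` to the intersection, which is quasi-isomorphic to `K`.

The total complex of the given double complex is thus connected by two quasi-isomorphisms to the
shift of the direct image of `K`. The latter is K-injective, so that the quasi-isomorphism pointing in
the wrong direction can be inverted up to homotopy (`exists_quasiIso_of_isKInjective`).
-/

noncomputable section

/-! ### Total complexes -/

namespace HomologicalComplex₂

open HomologicalComplex

variable {C : Type*} [Category* C]

section

variable [Preadditive C] (D E : HomologicalComplex₂ C (ComplexShape.up ℤ) (ComplexShape.up ℤ))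
  [D.HasTotal (ComplexShape.up ℤ)] [E.HasTotal (ComplexShape.up ℤ)]

/-- The projection of the total complex onto the summand in bidegree `(p, q)`. -/
def πTotal (p q n : ℤ) (h : p + q = n) :
    (D.total (ComplexShape.up ℤ)).X n ⟶ (D.X p).X q :=
  D.totalDesc fun p' q' h' =>
    if hp : p' = p then (D.XXIsoOfEq _ _ _ hp (by
      have : p' + q' = n := h'
      omega)).hom else 0

lemma ιTotal_πTotal (p q n : ℤ) (h : p + q = n) :
    D.ιTotal (ComplexShape.up ℤ) p q n h ≫ D.πTotal p q n h = 𝟙 _ := by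
  simp [πTotal]

lemma ιTotal_πTotal_of_ne (p q p' q' n : ℤ) (h : p + q = n) (h' : p' + q' = n) (hp : p ≠ p') :
    D.ιTotal (ComplexShape.up ℤ) p q n h ≫ D.πTotal p' q' n h' = 0 := by
  simp [πTotal, hp]

lemma ιTotal_πTotal_assoc (p q n : ℤ) (h : p + q = n) {A : C} (f : (D.X p).X q ⟶ A) :
    D.ιTotal (ComplexShape.up ℤ) p q n h ≫ D.πTotal p q n h ≫ f = f := by
  rw [← Category.assoc, ιTotal_πTotal, Category.id_comp]

lemma ιTotal_πTotal_of_ne_assoc (p q p' q' n : ℤ) (h : p + q = n) (h' : p' + q' = n)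
    (hp : p ≠ p') {A : C} (f : (D.X p').X q' ⟶ A) :
    D.ιTotal (ComplexShape.up ℤ) p q n h ≫ D.πTotal p' q' n h' ≫ f = 0 := by
  rw [← Category.assoc, ιTotal_πTotal_of_ne _ _ _ _ _ _ _ _ hp, zero_comp]

variable {D E} in
lemma total_map_πTotal (f : D ⟶ E) (p q n : ℤ) (h : p + q = n) :
    (total.map f (ComplexShape.up ℤ)).f n ≫ E.πTotal p q n h =
      D.πTotal p q n h ≫ (f.f p).f q := by
  apply total.hom_ext
  intro p' q' h'
  rw [ιTotal_map_assoc]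
  by_cases hp : p' = p
  · subst hp
    obtain rfl : q' = q := by
      have : p' + q' = n := h'
      omega
    rw [ιTotal_πTotal, ιTotal_πTotal_assoc, Category.comp_id]
  · rw [ιTotal_πTotal_of_ne _ _ _ _ _ _ h' _ hp, ιTotal_πTotal_of_ne_assoc _ _ _ _ _ _ h' _ hp,
      comp_zero]

lemma ιTotal_d (p q p' q' n n' : ℤ) (h : p + q = n) (hn : n + 1 = n') (hp : p + 1 = p')
    (hq : q + 1 = q') :
    D.ιTotal (ComplexShape.up ℤ) p q n h ≫ (D.total (ComplexShape.up ℤ)).d n n' =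
      (D.d p p').f q ≫ D.ιTotal (ComplexShape.up ℤ) p' q n' (by dsimp; omega) +
        p.negOnePow • ((D.X p).d q q' ≫
          D.ιTotal (ComplexShape.up ℤ) p q' n' (by dsimp; omega)) := by
  rw [total_d, Preadditive.comp_add, ι_D₁, ι_D₂,
    D.d₁_eq (ComplexShape.up ℤ) (i₁' := p') hp q n' (by dsimp; omega),
    D.d₂_eq (ComplexShape.up ℤ) p (i₂' := q') hq n' (by dsimp; omega)]
  simp [ComplexShape.ε₁, ComplexShape.ε₂, TotalComplexShape.ε₁, TotalComplexShape.ε₂]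

lemma total_d_πTotal (p₀ p q₀ q n n' : ℤ) (h : p + q = n') (hn : n + 1 = n') (hp : p₀ + 1 = p)
    (hq : q₀ + 1 = q) :
    (D.total (ComplexShape.up ℤ)).d n n' ≫ D.πTotal p q n' h =
      D.πTotal p₀ q n (by omega) ≫ (D.d p₀ p).f q +
        p.negOnePow • (D.πTotal p q₀ n (by omega) ≫ (D.X p).d q₀ q) := by
  apply total.hom_ext
  intro a b hab
  have hab' : a + b = n := hab
  rw [reassoc_of% (ιTotal_d D a b (a + 1) (b + 1) n n' hab' hn rfl rfl), Preadditive.add_comp,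
    Preadditive.comp_add, Category.assoc, Linear.units_smul_comp, Linear.comp_units_smul,
    Category.assoc]
  congr 1
  · by_cases ha : a + 1 = p
    · obtain rfl : a = p₀ := by omega
      obtain rfl : b = q := by omega
      subst hp
      rw [ιTotal_πTotal, ιTotal_πTotal_assoc, Category.comp_id]
    · rw [ιTotal_πTotal_of_ne _ _ _ _ _ _ _ _ ha,
        ιTotal_πTotal_of_ne_assoc _ _ _ _ _ _ _ _ (by omega), comp_zero]
  · by_cases ha : a = p
    · subst ha
      obtain rfl : b = q₀ := by omega
      subst hq
      rw [ιTotal_πTotal, ιTotal_πTotal_assoc, Category.comp_id]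
    · rw [ιTotal_πTotal_of_ne _ _ _ _ _ _ _ _ ha,
        ιTotal_πTotal_of_ne_assoc _ _ _ _ _ _ _ _ ha, comp_zero, smul_zero, smul_zero]

/-- A double complex is in the first quadrant if its terms outside it vanish. -/
def IsFirstQuadrant : Prop :=
  ∀ p q : ℤ, p < 0 ∨ q < 0 → IsZero ((D.X p).X q)

variable {D} in
lemma IsFirstQuadrant.eq_zero_of_forall_comp_πTotal (hD : D.IsFirstQuadrant) {A : C} {n : ℤ}
    (x : A ⟶ (D.total (ComplexShape.up ℤ)).X n)
    (hx : ∀ p q h, x ≫ D.πTotal p q n h = 0) : x = 0 := by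
  have key : 𝟙 ((D.total (ComplexShape.up ℤ)).X n) = ∑ p ∈ Finset.Icc 0 n,
      D.πTotal p (n - p) n (by omega) ≫
        D.ιTotal (ComplexShape.up ℤ) p (n - p) n (by dsimp; omega) := by
    apply total.hom_ext
    intro p q h
    have h' : p + q = n := h
    by_cases hp : 0 ≤ p ∧ 0 ≤ q
    · obtain rfl : q = n - p := by omega
      rw [Preadditive.comp_sum, Finset.sum_eq_single p, ιTotal_πTotal_assoc, Category.comp_id]
      · intro p' _ hp'
        rw [ιTotal_πTotal_of_ne_assoc _ _ _ _ _ _ _ _ hp'.symm]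
      · intro hp'
        exact (hp' (Finset.mem_Icc.mpr ⟨by omega, by omega⟩)).elim
    · exact (hD p q (by omega)).eq_of_src _ _
  rw [← Category.comp_id x, key, Preadditive.comp_sum]
  exact Finset.sum_eq_zero fun p _ => by rw [reassoc_of% (hx p), zero_comp]

end

end HomologicalComplex₂

namespace HomologicalComplex

variable {C : Type*} [Category* C] [Abelian C] {P Q : CochainComplex C ℤ} (f : P ⟶ Q)

/-- Exactness of the mapping cone of `f`, spelled out with generalized elements: every pair of a
cocycle `a` of `P` and an element `b` of `Q` with `f a = d b` is, after a refinement, a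
boundary. -/
lemma quasiIso_iff_pairs_up_to_refinements :
    QuasiIso f ↔ ∀ ⦃i j k l : ℤ⦄ (_ : i + 1 = j) (_ : j + 1 = k) (_ : k + 1 = l) ⦃A : C⦄
      (a : A ⟶ P.X k) (b : A ⟶ Q.X j) (_ : a ≫ P.d k l = 0) (_ : a ≫ f.f k = b ≫ Q.d j k),
      ∃ (A' : C) (π : A' ⟶ A) (_ : Epi π) (a' : A' ⟶ P.X j) (b' : A' ⟶ Q.X i),
        π ≫ a = a' ≫ P.d j k ∧ π ≫ b = a' ≫ f.f j + b' ≫ Q.d i j := by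
  constructor
  · intro hf i j k l hij hjk hkl A a b ha hab
    have h₁ : Mono (homologyMap f k) := inferInstance
    have h₂ : Epi (homologyMap f j) := inferInstance
    rw [mono_homologyMap_iff_up_to_refinements f j k l (by simp; omega) (by simp; omega)] at h₁
    rw [epi_homologyMap_iff_up_to_refinements f i j k (by simp; omega) (by simp; omega)] at h₂
    obtain ⟨A₁, π₁, _, x, hx⟩ := h₁ a ha b hab
    obtain ⟨A₂, π₂, _, y, hy, z, hz⟩ := h₂ (π₁ ≫ b - x ≫ f.f j) (by
      rw [Preadditive.sub_comp, Category.assoc, Category.assoc, f.comm, ← hab, reassoc_of% hx,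
        sub_self])
    refine ⟨A₂, π₂ ≫ π₁, inferInstance, π₂ ≫ x + y, z, ?_, ?_⟩
    · rw [Preadditive.add_comp, hy, add_zero, Category.assoc, Category.assoc, hx]
    · rw [Preadditive.comp_sub] at hz
      rw [Preadditive.add_comp, add_assoc, ← hz, Category.assoc, Category.assoc, add_sub_cancel]
  · intro H
    rw [quasiIso_iff]
    intro n
    rw [quasiIsoAt_iff_isIso_homologyMap]
    have h₁ : Mono (homologyMap f n) := by
      rw [mono_homologyMap_iff_up_to_refinements f (n - 1) n (n + 1) (by simp) (by simp)]
      intro A a ha b hab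
      obtain ⟨A', π, hπ, a', b', h, -⟩ := H (i := n - 2) (by omega) (by omega) rfl a b ha hab
      exact ⟨A', π, hπ, a', h⟩
    have h₂ : Epi (homologyMap f n) := by
      rw [epi_homologyMap_iff_up_to_refinements f (n - 1) n (n + 1) (by simp) (by simp)]
      intro A b hb
      obtain ⟨A', π, hπ, a', b', h, h'⟩ := H (i := n - 1) (j := n) (k := n + 1) (l := n + 2)
        (by omega) (by omega) (by omega) (0 : A ⟶ _) b (by simp) (by simp [hb])
      exact ⟨A', π, hπ, a', by rw [← h, comp_zero], b', h'⟩
    exact isIso_of_mono_of_epi _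

end HomologicalComplex

namespace HomologicalComplex₂

open HomologicalComplex

variable {C : Type*} [Category* C] [Abelian C]
  {D E : HomologicalComplex₂ C (ComplexShape.up ℤ) (ComplexShape.up ℤ)}
  [D.HasTotal (ComplexShape.up ℤ)] [E.HasTotal (ComplexShape.up ℤ)]

/-- A morphism of first quadrant double complexes which is a quasi-isomorphism on every column
induces a quasi-isomorphism on total complexes. -/
theorem quasiIso_total_map (hD : D.IsFirstQuadrant) (hE : E.IsFirstQuadrant) (f : D ⟶ E)
    (hf : ∀ p, QuasiIso (f.f p)) : QuasiIso (total.map f (ComplexShape.up ℤ)) := by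
  rw [quasiIso_iff_pairs_up_to_refinements]
  intro i j k l hij hjk hkl A a b ha hab
  -- Boundaries are subtracted to clear the columns one after another, starting with the column `0`.
  have key (m : ℕ) : ∃ (A' : C) (π : A' ⟶ A) (_ : Epi π)
      (a' : A' ⟶ (D.total (ComplexShape.up ℤ)).X j) (b' : A' ⟶ (E.total (ComplexShape.up ℤ)).X i),
      (∀ p q h, p < (m : ℤ) →
        (π ≫ a - a' ≫ (D.total (ComplexShape.up ℤ)).d j k) ≫ D.πTotal p q k h = 0) ∧
      (∀ p q h, p < (m : ℤ) →
        (π ≫ b - (a' ≫ (total.map f (ComplexShape.up ℤ)).f j +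
          b' ≫ (E.total (ComplexShape.up ℤ)).d i j)) ≫ E.πTotal p q j h = 0) := by
    induction m with
    | zero =>
      exact ⟨A, 𝟙 A, inferInstance, 0, 0,
        fun p q h hp => (hD p q (Or.inl hp)).eq_of_tgt _ _,
        fun p q h hp => (hE p q (Or.inl hp)).eq_of_tgt _ _⟩
    | succ m ih =>
      obtain ⟨A₁, π₁, _, a₁, b₁, h₁, h₂⟩ := ih
      set x := π₁ ≫ a - a₁ ≫ (D.total (ComplexShape.up ℤ)).d j k with hx
      set y := π₁ ≫ b - (a₁ ≫ (total.map f (ComplexShape.up ℤ)).f j +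
          b₁ ≫ (E.total (ComplexShape.up ℤ)).d i j) with hy
      have hx' : x ≫ (D.total (ComplexShape.up ℤ)).d k l = 0 := by
        simp [hx, ha]
      have hxy : x ≫ (total.map f (ComplexShape.up ℤ)).f k =
          y ≫ (E.total (ComplexShape.up ℤ)).d j k := by
        simp [hx, hy, hab]
      have e₁ := congrArg (· ≫ D.πTotal m (l - m) l (by omega)) hx'
      have e₂ := congrArg (· ≫ E.πTotal m (k - m) k (by omega)) hxy
      rw [Category.assoc, total_d_πTotal D (m - 1) m (k - m) (l - m) k l (by omega) hkl (by omega)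
        (by omega), Preadditive.comp_add, reassoc_of% (h₁ (m - 1) (l - m) (by omega) (by omega)),
        zero_comp, zero_add, Linear.comp_units_smul, zero_comp] at e₁
      rw [Category.assoc, Category.assoc, total_map_πTotal,
        total_d_πTotal E (m - 1) m (j - m) (k - m) j k (by omega) hjk (by omega)
        (by omega), Preadditive.comp_add, reassoc_of% (h₂ (m - 1) (k - m) (by omega) (by omega)),
        zero_comp, zero_add, Linear.comp_units_smul] at e₂
      obtain ⟨A₂, π₂, _, a₂, b₂, h₃, h₄⟩ := (quasiIso_iff_pairs_up_to_refinements (f.f m)).mp (hf m)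
        (i := i - m) (j := j - m) (k := k - m) (l := l - m) (by omega) (by omega) (by omega)
        ((m : ℤ).negOnePow • x ≫ D.πTotal m (k - m) k (by omega))
        (y ≫ E.πTotal m (j - m) j (by omega))
        (by rw [Linear.units_smul_comp, Category.assoc, e₁])
        (by rw [Linear.units_smul_comp, Category.assoc, e₂, smul_smul, Int.units_mul_self, one_smul,
              Category.assoc])
      refine ⟨A₂, π₂ ≫ π₁, inferInstance,
        π₂ ≫ a₁ + a₂ ≫ D.ιTotal (ComplexShape.up ℤ) m (j - m) j (by dsimp; omega),
        π₂ ≫ b₁ + (m : ℤ).negOnePow • b₂ ≫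
          E.ιTotal (ComplexShape.up ℤ) m (i - m) i (by dsimp; omega), ?_, ?_⟩
      · intro p q h hp
        have : (π₂ ≫ π₁) ≫ a - (π₂ ≫ a₁ + a₂ ≫
            D.ιTotal (ComplexShape.up ℤ) m (j - m) j (by dsimp; omega)) ≫
              (D.total (ComplexShape.up ℤ)).d j k = π₂ ≫ x -
            a₂ ≫ D.ιTotal (ComplexShape.up ℤ) m (j - m) j (by dsimp; omega) ≫
              (D.total (ComplexShape.up ℤ)).d j k := by
          simp only [hx, Preadditive.add_comp, Preadditive.comp_sub, Category.assoc]
          abel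
        rw [this, ιTotal_d D m (j - m) (m + 1) (k - m) j k (by omega) hjk rfl (by omega)]
        simp only [Preadditive.sub_comp, Preadditive.comp_add, Preadditive.add_comp,
          Category.assoc, Linear.units_smul_comp, Linear.comp_units_smul]
        rw [ιTotal_πTotal_of_ne _ _ _ _ _ _ _ _ (by omega), comp_zero, comp_zero, zero_add]
        rcases (by omega : p < m ∨ p = m) with hp | rfl
        · rw [h₁ p q h hp, ιTotal_πTotal_of_ne _ _ _ _ _ _ _ _ (by omega)]
          simp
        · obtain rfl : q = k - m := by omega
          rw [ιTotal_πTotal, Category.comp_id, ← h₃, Linear.comp_units_smul, smul_smul,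
            Int.units_mul_self, one_smul, sub_self]
      · intro p q h hp
        have : (π₂ ≫ π₁) ≫ b - ((π₂ ≫ a₁ + a₂ ≫
            D.ιTotal (ComplexShape.up ℤ) m (j - m) j (by dsimp; omega)) ≫
              (total.map f (ComplexShape.up ℤ)).f j + (π₂ ≫ b₁ + (m : ℤ).negOnePow • b₂ ≫
          E.ιTotal (ComplexShape.up ℤ) m (i - m) i (by dsimp; omega)) ≫
              (E.total (ComplexShape.up ℤ)).d i j) = π₂ ≫ y -
            (a₂ ≫ D.ιTotal (ComplexShape.up ℤ) m (j - m) j (by dsimp; omega) ≫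
              (total.map f (ComplexShape.up ℤ)).f j + (m : ℤ).negOnePow • b₂ ≫
              E.ιTotal (ComplexShape.up ℤ) m (i - m) i (by dsimp; omega) ≫
              (E.total (ComplexShape.up ℤ)).d i j) := by
          simp only [hy, Preadditive.add_comp, Preadditive.comp_sub, Preadditive.comp_add,
            Category.assoc, Linear.units_smul_comp]
          abel
        rw [this, ιTotal_d E m (i - m) (m + 1) (j - m) i j (by omega) hij rfl (by omega)]
        simp only [Preadditive.sub_comp, Preadditive.comp_add, Preadditive.add_comp,
          Category.assoc, Linear.units_smul_comp, Linear.comp_units_smul, ιTotal_map_assoc]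
        rw [ιTotal_πTotal_of_ne E (m + 1) _ _ _ _ _ _ (by omega), comp_zero, comp_zero, zero_add]
        rcases (by omega : p < m ∨ p = m) with hp | rfl
        · rw [h₂ p q h hp, ιTotal_πTotal_of_ne _ _ _ _ _ _ _ _ (by omega)]
          simp
        · obtain rfl : q = j - m := by omega
          rw [ιTotal_πTotal, Category.comp_id, Category.comp_id, h₄, smul_smul,
            Int.units_mul_self]
          simp
  obtain ⟨A', π, hπ, a', b', h₁, h₂⟩ := key ((k + 1).toNat)
  refine ⟨A', π, hπ, a', b', sub_eq_zero.mp ?_, sub_eq_zero.mp ?_⟩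
  · refine hD.eq_zero_of_forall_comp_πTotal _ fun p q h => ?_
    by_cases hp : p < (k + 1).toNat
    · exact h₁ p q h hp
    · exact (hD p q (Or.inr (by omega))).eq_of_tgt _ _
  · refine hE.eq_zero_of_forall_comp_πTotal _ fun p q h => ?_
    by_cases hp : p < (k + 1).toNat
    · exact h₂ p q h hp
    · exact (hE p q (Or.inr (by omega))).eq_of_tgt _ _

end HomologicalComplex₂

/-! ### Projection of a total complex to a shifted complex -/

namespace HomologicalComplex₂

open HomologicalComplex

variable {C : Type*} [Category* C]

section

variable [Preadditive C] (D : HomologicalComplex₂ C (ComplexShape.up ℤ) (ComplexShape.up ℤ))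
  [D.HasTotal (ComplexShape.up ℤ)] {N : ℤ} {M : CochainComplex C ℤ}

/-- A morphism from the column of index `N` to a complex `M` that vanishes on the image of the
preceding column induces a morphism from the total complex to `M[-N]`. -/
def totalToShift (ε : D.X N ⟶ M) (hε : D.d (N - 1) N ≫ ε = 0) :
    D.total (ComplexShape.up ℤ) ⟶ (shiftFunctor (CochainComplex C ℤ) (-N)).obj M where
  f n := D.πTotal N (n + -N) n (by omega) ≫ ε.f (n + -N)
  comm' n n' (hn : n + 1 = n') := by
    have h : (D.d (N - 1) N).f (n' + -N) ≫ ε.f (n' + -N) = 0 := by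
      rw [← comp_f, hε, zero_f]
    have h' : (D.πTotal N (n + -N) n (by omega) ≫ ε.f (n + -N)) ≫
        ((-N).negOnePow • M.d (n + -N) (n' + -N)) =
          (D.total (ComplexShape.up ℤ)).d n n' ≫ D.πTotal N (n' + -N) n' (by omega) ≫
            ε.f (n' + -N) := by
      rw [reassoc_of% (D.total_d_πTotal (N - 1) N (n + -N) (n' + -N)
        n n' (by omega) hn (by omega) (by omega)), Int.negOnePow_neg]
      simp only [Preadditive.add_comp, Category.assoc, h, comp_zero, zero_add,
        Linear.units_smul_comp, Linear.comp_units_smul, ε.comm]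
    exact h'

lemma comp_totalToShift_f (ε : D.X N ⟶ M) (hε : D.d (N - 1) N ≫ ε = 0) {A : C} {n : ℤ}
    (x : A ⟶ (D.total (ComplexShape.up ℤ)).X n) :
    x ≫ (D.totalToShift ε hε).f n = (x ≫ D.πTotal N (n + -N) n (by omega)) ≫ ε.f (n + -N) :=
  (Category.assoc _ _ _).symm

end

variable [Abelian C] {D : HomologicalComplex₂ C (ComplexShape.up ℤ) (ComplexShape.up ℤ)}
  [D.HasTotal (ComplexShape.up ℤ)] {N : ℤ} {M : CochainComplex C ℤ}

/-- If the augmented rows `0 ⟶ D⁰ ⟶ ⋯ ⟶ Dᴺ ⟶ M ⟶ 0` of a first quadrant double complex are split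
exact, then the total complex is quasi-isomorphic to `M[-N]`. Split exactness is expressed by lifting
generalized elements. -/
theorem quasiIso_totalToShift (hD : D.IsFirstQuadrant) (hD' : ∀ p q, N < p → IsZero ((D.X p).X q))
    (ε : D.X N ⟶ M) (hε : D.d (N - 1) N ≫ ε = 0)
    (lift_ε : ∀ ⦃q : ℤ⦄ ⦃A : C⦄ (b : A ⟶ M.X q), ∃ y, y ≫ ε.f q = b)
    (lift_last : ∀ ⦃q : ℤ⦄ ⦃A : C⦄ (c : A ⟶ (D.X N).X q), c ≫ ε.f q = 0 →
      ∃ y, y ≫ (D.d (N - 1) N).f q = c)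
    (lift_d : ∀ ⦃p₀ p p₁ q : ℤ⦄ (_ : p₀ + 1 = p) (_ : p + 1 = p₁) (_ : p < N) ⦃A : C⦄
      (c : A ⟶ (D.X p).X q), c ≫ (D.d p p₁).f q = 0 → ∃ y, y ≫ (D.d p₀ p).f q = c) :
    QuasiIso (D.totalToShift ε hε) := by
  rw [quasiIso_iff_pairs_up_to_refinements]
  intro i j k l hij hjk hkl A a b ha hab
  -- Boundaries are subtracted to clear the columns one after another, starting with the column `N`.
  have key (m : ℕ) : ∃ a' : A ⟶ (D.total (ComplexShape.up ℤ)).X j,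
      b = a' ≫ (D.totalToShift ε hε).f j ∧ ∀ p q h, N - m < p →
        (a - a' ≫ (D.total (ComplexShape.up ℤ)).d j k) ≫ D.πTotal p q k h = 0 := by
    induction m with
    | zero =>
      obtain ⟨y, hy⟩ := lift_ε (q := j + -N) b
      refine ⟨y ≫ D.ιTotal (ComplexShape.up ℤ) N (j + -N) j (by dsimp; omega), ?_,
        fun p q h hp => (hD' p q (by simpa using hp)).eq_of_tgt _ _⟩
      have e : (y ≫ D.ιTotal (ComplexShape.up ℤ) N (j + -N) j (by dsimp; omega)) ≫
          D.πTotal N (j + -N) j (by omega) = y := by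
        rw [Category.assoc, ιTotal_πTotal, Category.comp_id]
      rw [comp_totalToShift_f, e]
      exact hy.symm
    | succ m ih =>
      obtain ⟨a', hb, h₁⟩ := ih
      set x := a - a' ≫ (D.total (ComplexShape.up ℤ)).d j k with hx
      have hx' : x ≫ (D.total (ComplexShape.up ℤ)).d k l = 0 := by
        simp [hx, ha]
      have hxε : x ≫ (D.totalToShift ε hε).f k = 0 := by
        rw [hx, Preadditive.sub_comp, hab, Category.assoc, ← (D.totalToShift ε hε).comm, hb,
          Category.assoc, sub_self]
      have lift (p : ℤ) (hp : p = N - m) : ∃ y, y ≫ (D.d (p - 1) p).f (k - p) =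
          x ≫ D.πTotal p (k - p) k (by omega) := by
        by_cases hpN : p = N
        · subst hpN
          refine lift_last _ ?_
          rw [comp_totalToShift_f] at hxε
          exact hxε
        · refine lift_d (p₁ := p + 1) (by omega) rfl (by omega) _ ?_
          have e := congrArg (· ≫ D.πTotal (p + 1) (k - p) l (by omega)) hx'
          rw [Category.assoc, total_d_πTotal D p (p + 1) (k - p - 1) (k - p) k l (by omega) hkl rfl
            (by omega), Preadditive.comp_add, Linear.comp_units_smul,
            reassoc_of% (h₁ (p + 1) (k - p - 1) (by omega) (by omega)),
            zero_comp, smul_zero, add_zero, zero_comp] at e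
          rw [Category.assoc, e]
      obtain ⟨y, hy⟩ := lift (N - m) rfl
      refine ⟨a' + y ≫ D.ιTotal (ComplexShape.up ℤ) (N - m - 1) (k - (N - m)) j (by dsimp; omega),
        ?_, fun p q h hp => ?_⟩
      · have e : (y ≫ D.ιTotal (ComplexShape.up ℤ) (N - m - 1) (k - (N - m)) j
            (by dsimp; omega)) ≫ D.πTotal N (j + -N) j (by omega) = 0 := by
          rw [Category.assoc, ιTotal_πTotal_of_ne _ _ _ _ _ _ _ _ (by omega), comp_zero]
        rw [hb, Preadditive.add_comp, left_eq_add, comp_totalToShift_f, e, zero_comp]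
        rfl
      · have : a - (a' + y ≫ D.ιTotal (ComplexShape.up ℤ) (N - m - 1) (k - (N - m)) j
            (by dsimp; omega)) ≫ (D.total (ComplexShape.up ℤ)).d j k = x -
              y ≫ D.ιTotal (ComplexShape.up ℤ) (N - m - 1) (k - (N - m)) j
            (by dsimp; omega) ≫ (D.total (ComplexShape.up ℤ)).d j k := by
          simp only [hx, Preadditive.add_comp, Category.assoc]
          abel
        rw [this, ιTotal_d D _ _ (N - m) (k - (N - m) + 1) j k (by omega) hjk (by omega) rfl]
        simp only [Preadditive.sub_comp, Preadditive.comp_add, Preadditive.add_comp,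
          Category.assoc, Linear.units_smul_comp, Linear.comp_units_smul]
        rw [ιTotal_πTotal_of_ne D (N - m - 1) _ _ _ _ _ _ (by omega), comp_zero, comp_zero,
          smul_zero, add_zero]
        rcases (by omega : N - m < p ∨ p = N - m) with hp | rfl
        · rw [h₁ p q h hp, ιTotal_πTotal_of_ne _ _ _ _ _ _ _ _ (by omega)]
          simp
        · obtain rfl : q = k - (N - m) := by omega
          rw [ιTotal_πTotal, Category.comp_id, hy, sub_self]
  obtain ⟨a', hb, h₁⟩ := key (N + 1).toNat
  refine ⟨A, 𝟙 A, inferInstance, a', 0, ?_, by rw [zero_comp, add_zero, Category.id_comp, hb]⟩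
  rw [Category.id_comp, ← sub_eq_zero]
  refine hD.eq_zero_of_forall_comp_πTotal _ fun p q h => ?_
  by_cases hp : N - (N + 1).toNat < p
  · exact h₁ p q h hp
  · exact (hD p q (Or.inl (by omega))).eq_of_tgt _ _

end HomologicalComplex₂

/-! ### K-injective complexes -/

namespace CochainComplex

open HomologicalComplex

variable {C D : Type*} [Category* C] [Abelian C] [Category* D] [Abelian D]

/-- Zigzags of quasi-isomorphisms `B ⟵ A ⟶ Q` ending in a K-injective complex can be replaced by
quasi-isomorphisms `B ⟶ Q`. -/
lemma exists_quasiIso_of_isKInjective {A B Q : CochainComplex C ℤ} [Q.IsKInjective]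
    (s : A ⟶ B) (g : A ⟶ Q) (hs : QuasiIso s) (hg : QuasiIso g) : ∃ φ : B ⟶ Q, QuasiIso φ := by
  let := HasDerivedCategory.standard C
  obtain ⟨φ, hφ⟩ := (IsKInjective.Qh_map_bijective
      ((HomotopyCategory.quotient C (ComplexShape.up ℤ)).obj B) Q).surjective
    ((DerivedCategory.quotientCompQhIso C).hom.app B ≫ inv (DerivedCategory.Q.map s) ≫
      DerivedCategory.Q.map g ≫ (DerivedCategory.quotientCompQhIso C).inv.app Q)
  obtain ⟨φ, rfl⟩ := (HomotopyCategory.quotient C (ComplexShape.up ℤ)).map_surjective φ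
  refine ⟨φ, ?_⟩
  rw [← DerivedCategory.isIso_Q_map_iff_quasiIso]
  have h := (DerivedCategory.quotientCompQhIso C).inv.naturality φ
  have : IsIso (DerivedCategory.Qh.map
      ((HomotopyCategory.quotient C (ComplexShape.up ℤ)).map φ)) := by
    rw [hφ]; infer_instance
  have h' : DerivedCategory.Q.map φ = (DerivedCategory.quotientCompQhIso C).inv.app B ≫
      DerivedCategory.Qh.map ((HomotopyCategory.quotient C (ComplexShape.up ℤ)).map φ) ≫
        (DerivedCategory.quotientCompQhIso C).hom.app Q := by
    rw [← cancel_mono ((DerivedCategory.quotientCompQhIso C).inv.app Q), h]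
    simp
  rw [h']
  infer_instance

/-- Additive functors preserve quasi-isomorphisms between K-injective complexes. -/
lemma quasiIso_mapHomologicalComplex_map_of_isKInjective (F : C ⥤ D) [F.Additive]
    {K L : CochainComplex C ℤ} [K.IsKInjective] [L.IsKInjective] (f : K ⟶ L) (hf : QuasiIso f) :
    QuasiIso ((F.mapHomologicalComplex (ComplexShape.up ℤ)).map f) := by
  rw [IsKInjective.quasiIso_iff] at hf
  obtain ⟨e, rfl⟩ := hf
  exact inferInstanceAs (QuasiIso (F.mapHomotopyEquiv e).hom)

end CochainComplex

/-! ### Discontinuous sections and restriction of injective sheaves to open subspaces -/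

namespace CechComplement

open Opposite

variable {Y : TopCat.{u}}

/-- The sheaf of discontinuous sections of a family of vector spaces indexed by the points. -/
def discontinuousSections (V : Y → CVect.{u}) : Sh Y where
  obj :=
    { obj := fun O => ModuleCat.of _ (∀ x : O.unop, V x)
      map := fun {O O'} i => ModuleCat.ofHom
        (LinearMap.pi fun x : O'.unop => LinearMap.proj (⟨x.1, i.unop.le x.2⟩ : O.unop)) }
  property := by
    refine (Presheaf.isSheaf_iff_isSheaf_comp (forget CVect.{u}) _).mpr ?_
    exact Presheaf.toTypes_isSheaf Y fun x => V x

variable {V : Y → CVect.{u}}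

/-- The value of a discontinuous section at a point. -/
def evalAt (O : Opens Y) (x : O) : (discontinuousSections V).obj.obj (op O) ⟶ V x :=
  ModuleCat.ofHom (LinearMap.proj x)

/-- Linear maps on stalks define a morphism to a sheaf of discontinuous sections. -/
def ofStalks (F : Sh Y) (φ : ∀ x, F.presheaf.stalk x ⟶ V x) : F ⟶ discontinuousSections V :=
  ⟨{ app := fun O => ModuleCat.ofHom (LinearMap.pi fun x : O.unop =>
        (F.presheaf.germ O.unop x x.2 ≫ φ x).hom)
     naturality := fun O O' i => by
      ext s
      funext x
      change (F.presheaf.germ O'.unop x x.2 ≫ φ x).hom ((F.presheaf.map i).hom s) =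
        (F.presheaf.germ O.unop x (i.unop.le x.2) ≫ φ x).hom s
      have := F.presheaf.germ_res i.unop x x.2
      rw [← this]
      rfl }⟩

/-- The linear map on the stalk at `x` that is induced by a morphism to a sheaf of discontinuous
sections. -/
def toFiber {F : Sh Y} (f : F ⟶ discontinuousSections V) (x : Y) : F.presheaf.stalk x ⟶ V x :=
  colimit.desc ((OpenNhds.inclusion x).op ⋙ F.presheaf)
    { pt := V x
      ι :=
        { app := fun O => f.hom.app (op O.unop.1) ≫ evalAt O.unop.1 ⟨x, O.unop.2⟩
          naturality := fun O O' i => by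
            have := f.hom.naturality ((OpenNhds.inclusion x).op.map i)
            dsimp at this ⊢
            rw [Category.comp_id]
            erw [reassoc_of% this]
            rfl } }

lemma germ_toFiber {F : Sh Y} (f : F ⟶ discontinuousSections V) (O : Opens Y) (x : Y)
    (hx : x ∈ O) :
    F.presheaf.germ O x hx ≫ toFiber f x = f.hom.app (op O) ≫ evalAt O ⟨x, hx⟩ :=
  colimit.ι_desc (F := (OpenNhds.inclusion x).op ⋙ F.presheaf) _ (op ⟨O, hx⟩)

lemma hom_ext_discontinuousSections {F : Sh Y} {f g : F ⟶ discontinuousSections V}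
    (h : ∀ (O : Opens Y) (x : O), f.hom.app (op O) ≫ evalAt O x = g.hom.app (op O) ≫ evalAt O x) :
    f = g := by
  apply CategoryTheory.Sheaf.hom_ext
  apply NatTrans.ext
  funext O
  apply ModuleCat.hom_ext
  apply LinearMap.ext
  intro s
  funext x
  exact congrArg (fun φ => φ.hom s) (h O.unop x)

instance injective_CVect (W : CVect.{u}) : Injective W :=
  have := Module.injective_of_isSemisimpleRing (ULift.{u} ℂ) W
  Module.injective_object_of_injective_module (ULift.{u} ℂ) W

/-- A morphism to the sheaf of discontinuous sections is the same as a family of linear maps on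
stalks; these can be extended along injections of vector spaces. -/
instance : Injective (discontinuousSections V) where
  factors {A B} g f _ := by
    let m (x : Y) : A.presheaf.stalk x ⟶ B.presheaf.stalk x :=
      (Presheaf.stalkFunctor CVect.{u} x).map f.hom
    have (x : Y) : Mono (m x) := Presheaf.stalk_mono_of_mono f x
    refine ⟨ofStalks B fun x => Injective.factorThru (toFiber g x) (m x), ?_⟩
    apply hom_ext_discontinuousSections
    intro O x
    have h₁ : A.presheaf.germ O x.1 x.2 ≫ m x.1 = f.hom.app (op O) ≫ B.presheaf.germ O x.1 x.2 :=
      Presheaf.stalkFunctor_map_germ (C := CVect.{u}) O x.1 x.2 f.hom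
    rw [← germ_toFiber g O x.1 x.2, ← Injective.comp_factorThru (toFiber g x.1) (m x.1),
      reassoc_of% h₁]
    rfl

/-- The embedding of a sheaf into the discontinuous sections of its family of stalks. -/
def toGodement (F : Sh Y) : F ⟶ discontinuousSections fun x => F.presheaf.stalk x :=
  ofStalks F fun _ => 𝟙 _

instance (F : Sh Y) : Mono (toGodement F) := by
  apply (sheafToPresheaf (Opens.grothendieckTopology Y) CVect.{u}).mono_of_mono_map
  have (O : (Opens Y)ᵒᵖ) : Mono ((toGodement F).hom.app O) := by
    rw [ModuleCat.mono_iff_injective]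
    intro s t h
    refine Presheaf.section_ext F O.unop s t fun x hx => ?_
    exact congrFun h ⟨x, hx⟩
  exact NatTrans.mono_of_mono_app (toGodement F).hom

/-- An injective sheaf is a direct summand of a sheaf of discontinuous sections. -/
lemma nonempty_retract_discontinuousSections (F : Sh Y) [Injective F] :
    Nonempty (Retract F (discontinuousSections fun x => F.presheaf.stalk x)) :=
  ⟨{ i := toGodement F
     r := Injective.factorThru (𝟙 F) (toGodement F)
     retract := Injective.comp_factorThru _ _ }⟩

variable {X : TopCat.{u}}

/-- The restriction of sheaves to an open subspace. -/
abbrev restr (W : Opens X) : Sh X ⥤ Sh ((Opens.toTopCat X).obj W) :=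
  W.isOpenEmbedding.sheafPullback CVect.{u}

/-- Restriction to an open subspace is left adjoint to the direct image functor. -/
def restrAdj (W : Opens X) : restr W ⊣ push W.inclusion' :=
  haveI := Topology.IsOpenEmbedding.functor_isContinuous W.isOpenEmbedding
  W.isOpenEmbedding.isOpenMap.adjunction.sheafPushforwardContinuous
    (Opens.grothendieckTopology _) (Opens.grothendieckTopology _)

/-- The restriction of discontinuous sections to an open subspace consists of the discontinuous
sections there. Only one half of this isomorphism is recorded, as a retract suffices to transport
injectivity. -/
def restrDiscontinuousSections (W : Opens X) (V : X → CVect.{u}) :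
    Retract ((restr W).obj (discontinuousSections V))
      (discontinuousSections fun x : (Opens.toTopCat X).obj W => V x.1) where
  i := ⟨{ app := fun O => ModuleCat.ofHom (LinearMap.pi fun x : O.unop =>
            LinearMap.proj (⟨x.1.1, x.1, x.2, rfl⟩ :
              (W.isOpenEmbedding.isOpenMap.functor.obj O.unop :))) }⟩
  r := ⟨{ app := fun O => ModuleCat.ofHom (LinearMap.pi
            fun x : (W.isOpenEmbedding.isOpenMap.functor.obj O.unop :) =>
            LinearMap.proj (φ := fun y : O.unop => V y.1.1) (⟨⟨x.1, by
              obtain ⟨y, hy, h⟩ := x.2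
              exact h ▸ y.2⟩, by
              obtain ⟨y, hy, h⟩ := x.2
              have e : y = ⟨x.1, h ▸ y.2⟩ := Subtype.ext h
              exact e ▸ hy⟩ : O.unop)) }⟩

instance injective_restr (W : Opens X) (F : Sh X) [Injective F] : Injective ((restr W).obj F) := by
  obtain ⟨e⟩ := nonempty_retract_discontinuousSections F
  exact ((e.map (restr W)).trans (restrDiscontinuousSections W _)).injective

instance (W : Opens X) : (restr W).Additive where

instance (W : Opens X) : PreservesFiniteLimits (restr W) :=
  haveI := Topology.IsOpenEmbedding.functor_isContinuous W.isOpenEmbedding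
  have : (W.isOpenEmbedding.isOpenMap.functor.sheafPushforwardContinuous CVect.{u}
    (Opens.grothendieckTopology _) (Opens.grothendieckTopology _)).IsRightAdjoint := inferInstance
  have : (restr W).IsRightAdjoint := this
  inferInstance

instance (W : Opens X) : PreservesFiniteColimits (restr W) :=
  have := (restrAdj W).isLeftAdjoint
  inferInstance

instance injective_push (W : Opens X) (F : Sh ((Opens.toTopCat X).obj W)) [Injective F] :
    Injective ((push W.inclusion').obj F) :=
  Injective.injective_of_adjoint (restrAdj W) F

end CechComplement

/-! ### Incidence numbers of a simplex and their contractions -/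

namespace CechComplement

variable {r : ℕ}

/-- The incidence number of `J` and `K` in the cochain complex of a simplex: nonzero only if `K` is
obtained from `J` by adding one element, and then the sign of its position. -/
def incidence (J K : Finset (Fin r)) : ℤ :=
  if J ⊆ K ∧ K.card = J.card + 1 then (-1) ^ inversions J K else 0

lemma incidence_insert {J : Finset (Fin r)} {a : Fin r} (ha : a ∉ J) :
    incidence J (insert a J) = (-1) ^ inversions J (insert a J) :=
  if_pos ⟨Finset.subset_insert a J, Finset.card_insert_of_notMem ha⟩

lemma exists_of_incidence_ne_zero {J K : Finset (Fin r)} (h : incidence J K ≠ 0) :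
    ∃ a, a ∉ J ∧ K = insert a J := by
  rw [incidence] at h
  split_ifs at h with h'
  · obtain ⟨a, ha, h⟩ := Finset.exists_eq_insert_iff.mpr ⟨h'.1, h'.2.symm⟩
    exact ⟨a, ha, h.symm⟩
  · exact (h rfl).elim

lemma incidence_eq_zero {J K : Finset (Fin r)} (h : ∀ a, a ∉ J → K ≠ insert a J) :
    incidence J K = 0 := by
  by_contra h'
  obtain ⟨a, ha, h''⟩ := exists_of_incidence_ne_zero h'
  exact h a ha h''

lemma incidence_mul_self {J : Finset (Fin r)} {a : Fin r} (ha : a ∉ J) :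
    incidence J (insert a J) * incidence J (insert a J) = 1 := by
  rw [incidence_insert ha, ← mul_pow]
  norm_num

lemma incidence_swap {J : Finset (Fin r)} {a b : Fin r} (ha : a ∉ J) (hb : b ∉ J) (hab : a ≠ b) :
    incidence J (insert a J) * incidence (insert a J) (insert b (insert a J)) +
      incidence J (insert b J) * incidence (insert b J) (insert b (insert a J)) = 0 := by
  have h := sign_swap ha hb hab
  rw [Finset.insert_comm b a J, incidence_insert ha, incidence_insert hb,
    incidence_insert (by grind : a ∉ insert b J), Finset.insert_comm a b J,
    incidence_insert (by grind : b ∉ insert a J)]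
  exact h

lemma sum_incidence_mul_incidence (J L : Finset (Fin r)) :
    ∑ K, incidence J K * incidence K L = 0 := by
  by_cases h : ∃ a b, a ∉ J ∧ b ∉ J ∧ a ≠ b ∧ L = insert b (insert a J)
  · obtain ⟨a, b, ha, hb, hab, rfl⟩ := h
    rw [← incidence_swap ha hb hab, ← Finset.sum_pair (f := fun K => incidence J K *
      incidence K (insert b (insert a J))) (fun e => by
        have := e ▸ Finset.mem_insert_self a J
        grind : insert a J ≠ insert b J)]
    refine (Finset.sum_subset (Finset.subset_univ _) fun K _ hK => ?_).symm
    by_contra h'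
    obtain ⟨c, hc, rfl⟩ := exists_of_incidence_ne_zero (left_ne_zero_of_mul h')
    obtain ⟨d, hd, e⟩ := exists_of_incidence_ne_zero (right_ne_zero_of_mul h')
    have : c ∈ insert b (insert a J) := e ▸ by grind
    grind
  · refine Finset.sum_eq_zero fun K _ => ?_
    by_contra h'
    obtain ⟨c, hc, rfl⟩ := exists_of_incidence_ne_zero (left_ne_zero_of_mul h')
    obtain ⟨d, hd, e⟩ := exists_of_incidence_ne_zero (right_ne_zero_of_mul h')
    exact h ⟨c, d, hc, by grind, by grind, e⟩

/-- The contraction of the cochain complex of a simplex onto the vertex `k`. -/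
def contraction (k : Fin r) (K J : Finset (Fin r)) : ℤ :=
  if k ∉ J ∧ K = insert k J then incidence J K else 0

lemma contraction_insert {k : Fin r} {J : Finset (Fin r)} (hk : k ∉ J) :
    contraction k (insert k J) J = incidence J (insert k J) :=
  if_pos ⟨hk, rfl⟩

lemma of_contraction_ne_zero {k : Fin r} {K J : Finset (Fin r)} (h : contraction k K J ≠ 0) :
    k ∉ J ∧ K = insert k J := by
  by_contra h'
  exact h (if_neg h')

lemma contraction_homotopy (k : Fin r) (J J' : Finset (Fin r)) :
    ∑ K, incidence J K * contraction k K J' + ∑ K, contraction k J K * incidence K J' =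
      if J = J' then 1 else 0 := by
  have h₁ : ∑ K, incidence J K * contraction k K J' =
      if k ∈ J' then 0 else incidence J (insert k J') * incidence J' (insert k J') := by
    split_ifs with hk
    · refine Finset.sum_eq_zero fun K _ => ?_
      by_contra h
      exact (of_contraction_ne_zero (right_ne_zero_of_mul h)).1 hk
    · rw [Finset.sum_eq_single (insert k J'), contraction_insert hk]
      · intro K _ hK
        by_contra h
        exact hK (of_contraction_ne_zero (right_ne_zero_of_mul h)).2
      · simp
  have h₂ : ∑ K, contraction k J K * incidence K J' =
      if k ∈ J then incidence (J.erase k) J * incidence (J.erase k) J' else 0 := by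
    split_ifs with hk
    · rw [Finset.sum_eq_single (J.erase k)]
      · congr 1
        exact if_pos ⟨by simp, (Finset.insert_erase hk).symm⟩
      · intro K _ hK
        by_contra h
        obtain ⟨hk', rfl⟩ := of_contraction_ne_zero (left_ne_zero_of_mul h)
        exact hK (Finset.erase_insert hk').symm
      · simp
    · refine Finset.sum_eq_zero fun K _ => ?_
      by_contra h
      obtain ⟨h, rfl⟩ := of_contraction_ne_zero (left_ne_zero_of_mul h)
      grind
  rw [h₁, h₂]
  by_cases hk' : k ∈ J' <;> by_cases hk : k ∈ J
  · obtain ⟨J, hJ, rfl⟩ : ∃ L, k ∉ L ∧ J = insert k L :=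
      ⟨J.erase k, by simp, (Finset.insert_erase hk).symm⟩
    rw [if_pos hk', if_pos hk, Finset.erase_insert hJ, zero_add]
    split_ifs with h
    · rw [← h, incidence_mul_self hJ]
    · rw [incidence_eq_zero (K := J'), mul_zero]
      rintro a ha rfl
      grind
  · rw [if_pos hk', if_neg hk, if_neg (by grind), zero_add]
  · obtain ⟨J, hJ, rfl⟩ : ∃ L, k ∉ L ∧ J = insert k L :=
      ⟨J.erase k, by simp, (Finset.insert_erase hk).symm⟩
    rw [if_neg hk', if_pos hk, Finset.erase_insert hJ, if_neg (by grind)]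
    by_cases h : ∃ a, a ∉ J ∧ J' = insert a J
    · obtain ⟨a, ha, rfl⟩ := h
      have hak : a ≠ k := by grind
      have e := incidence_swap hJ ha hak.symm
      have e₁ := incidence_mul_self hJ
      have e₂ := incidence_mul_self hk'
      rw [Finset.insert_comm k a J] at e₂ ⊢
      linear_combination incidence J (insert k J) *
          incidence (insert a J) (insert a (insert k J)) * e -
        incidence (insert k J) (insert a (insert k J)) *
          incidence (insert a J) (insert a (insert k J)) * e₁ -
        incidence J (insert k J) * incidence J (insert a J) * e₂
    · rw [incidence_eq_zero (J := J) (K := J'), mul_zero, add_zero,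
        incidence_eq_zero (J := insert k J), zero_mul]
      · rintro a ha e
        refine h ⟨a, by grind, ?_⟩
        ext x
        have := Finset.ext_iff.mp e x
        grind
      · rintro a ha rfl
        exact h ⟨a, ha, rfl⟩
  · rw [if_neg hk', if_neg hk, add_zero]
    split_ifs with h
    · rw [h, incidence_mul_self hk']
    · rw [incidence_eq_zero, zero_mul]
      rintro a ha e
      apply h
      ext x
      have := Finset.ext_iff.mp e x
      have := Finset.ext_iff.mp e k
      grind

end CechComplement

/-! ### Complexes of cubes -/

namespace CechComplement

variable {r : ℕ}

section Cube

variable {A : Type*} [Category* A] [Preadditive A]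

/-- The component from the vertex `J` to the vertex `K` of the differential of a cube of objects:
the transition morphism multiplied by the incidence number. -/
def cubeEntry (P : Finset (Fin r) ⥤ A) (J K : Finset (Fin r)) : P.obj J ⟶ P.obj K :=
  if h : J ≤ K then incidence J K • P.map (homOfLE h) else 0

lemma cubeEntry_of_le (P : Finset (Fin r) ⥤ A) {J K : Finset (Fin r)} (h : J ≤ K) :
    cubeEntry P J K = incidence J K • P.map (homOfLE h) := dif_pos h

lemma cubeEntry_of_card (P : Finset (Fin r) ⥤ A) {J K : Finset (Fin r)}
    (h : K.card ≠ J.card + 1) : cubeEntry P J K = 0 := by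
  rw [cubeEntry]
  split_ifs
  · rw [incidence, if_neg (fun h' => h h'.2), zero_smul]
  · rfl

lemma incidence_of_not_le {J K : Finset (Fin r)} (h : ¬ J ≤ K) : incidence J K = 0 :=
  if_neg fun h' => h h'.1

lemma cubeEntry_naturality {P Q : Finset (Fin r) ⥤ A} (f : P ⟶ Q) (J K : Finset (Fin r)) :
    cubeEntry P J K ≫ f.app K = f.app J ≫ cubeEntry Q J K := by
  by_cases h : J ≤ K
  · simp [cubeEntry_of_le, h]
  · simp [cubeEntry, h]

lemma sum_cubeEntry_comp_cubeEntry (P : Finset (Fin r) ⥤ A) (J L : Finset (Fin r)) :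
    ∑ K, cubeEntry P J K ≫ cubeEntry P K L = 0 := by
  by_cases hJL : J ≤ L
  · have h (K : Finset (Fin r)) : cubeEntry P J K ≫ cubeEntry P K L =
        (incidence J K * incidence K L) • P.map (homOfLE hJL) := by
      by_cases h₁ : J ≤ K
      · by_cases h₂ : K ≤ L
        · rw [cubeEntry_of_le P h₁, cubeEntry_of_le P h₂, Preadditive.zsmul_comp,
            Preadditive.comp_zsmul, ← P.map_comp, smul_smul]
          rfl
        · rw [cubeEntry, cubeEntry, dif_neg h₂, comp_zero, incidence_of_not_le h₂, mul_zero,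
            zero_smul]
      · rw [cubeEntry, dif_neg h₁, zero_comp, incidence_of_not_le h₁, zero_mul, zero_smul]
    simp_rw [h]
    rw [← Finset.sum_smul, sum_incidence_mul_incidence, zero_smul]
  · refine Finset.sum_eq_zero fun K _ => ?_
    by_cases h₁ : J ≤ K
    · rw [cubeEntry, cubeEntry, dif_neg fun h₂ => hJL (h₁.trans h₂), comp_zero]
    · rw [cubeEntry, dif_neg h₁, zero_comp]

/-- Sums over `Idx r p` are sums over all subsets if the terms not indexed by `Idx r p` vanish. -/
lemma sum_idx {G : Type*} [AddCommMonoid G] (p : ℤ) (f : Finset (Fin r) → G)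
    (hf : ∀ K, (K.card : ℤ) = p → K = Finset.univ → f K = 0)
    (hf' : ∀ K, (K.card : ℤ) ≠ p → f K = 0) :
    ∑ K : Idx r p, f K.1 = ∑ K, f K := by
  refine Fintype.sum_of_injective Subtype.val Subtype.val_injective _ _ (fun K hK => ?_)
    fun _ => rfl
  by_cases h : (K.card : ℤ) = p
  · by_cases h' : K = Finset.univ
    · exact hf K h h'
    · exact (hK ⟨⟨K, h, h'⟩, rfl⟩).elim
  · exact hf' K h

lemma cubeEntry_comp_cubeEntry_of_eq_univ (P : Finset (Fin r) ⥤ A) (J L : Finset (Fin r))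
    {K : Finset (Fin r)} (hK : K = Finset.univ) : cubeEntry P J K ≫ cubeEntry P K L = 0 := by
  rw [cubeEntry_of_card P (J := K), comp_zero]
  have := L.card_le_univ
  rw [hK, Finset.card_univ]
  omega

lemma sum_idx_cubeEntry_comp_cubeEntry (P : Finset (Fin r) ⥤ A) {p q : ℤ} (hpq : p + 1 = q)
    (J : Idx r p) (L : Finset (Fin r)) :
    ∑ K : Idx r q, cubeEntry P J.1 K.1 ≫ cubeEntry P K.1 L = 0 := by
  rw [sum_idx q (fun K => cubeEntry P J.1 K ≫ cubeEntry P K L),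
    sum_cubeEntry_comp_cubeEntry]
  · exact fun K _ h => cubeEntry_comp_cubeEntry_of_eq_univ P _ _ h
  · intro K h
    have := J.2.1
    rw [cubeEntry_of_card P, zero_comp]
    omega

variable [HasFiniteBiproducts A]

/-- The complex whose term of degree `p` is the direct sum of the objects at the proper subsets with
`p` elements of a cube of objects. -/
def cubeComplex (P : Finset (Fin r) ⥤ A) : CochainComplex A ℤ where
  X p := ⨁ fun J : Idx r p => P.obj J.1
  d p q := if p + 1 = q then biproduct.matrix fun (J : Idx r p) (K : Idx r q) =>
    cubeEntry P J.1 K.1 else 0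
  shape _ _ h := if_neg h
  d_comp_d' p q s (hpq : p + 1 = q) (hqs : q + 1 = s) := by
    rw [if_pos hpq, if_pos hqs]
    apply biproduct.hom_ext'
    intro J
    apply biproduct.hom_ext
    intro L
    simp only [biproduct.ι_matrix_assoc, biproduct.matrix_π, biproduct.lift_desc, Category.assoc,
      comp_zero, zero_comp]
    exact sum_idx_cubeEntry_comp_cubeEntry P hpq J L.1

lemma cubeComplex_d (P : Finset (Fin r) ⥤ A) {p q : ℤ} (hpq : p + 1 = q) :
    (cubeComplex P).d p q = biproduct.matrix fun (J : Idx r p) (K : Idx r q) =>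
      cubeEntry P J.1 K.1 := if_pos hpq

/-- The augmentation of `cubeComplex P` to the object at the full set of indices. -/
def cubeAugmentation (P : Finset (Fin r) ⥤ A) (p : ℤ) :
    (cubeComplex P).X p ⟶ P.obj Finset.univ :=
  biproduct.desc fun J : Idx r p => cubeEntry P J.1 Finset.univ

lemma cubeComplex_d_comp_cubeAugmentation (P : Finset (Fin r) ⥤ A) {p q : ℤ} (hpq : p + 1 = q) :
    (cubeComplex P).d p q ≫ cubeAugmentation P q = 0 := by
  have h : (biproduct.matrix fun (J : Idx r p) (K : Idx r q) => cubeEntry P J.1 K.1) ≫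
      biproduct.desc (fun J : Idx r q => cubeEntry P J.1 Finset.univ) = 0 := by
    refine biproduct.hom_ext' _ _ fun J => ?_
    rw [biproduct.ι_matrix_assoc, biproduct.lift_desc, comp_zero]
    exact sum_idx_cubeEntry_comp_cubeEntry P hpq J Finset.univ
  rw [cubeComplex_d P hpq]
  exact h

/-- A contracting homotopy of the complex of all vertices of a cube of objects. The identity
`dh + hd = 1` is stated for the components from `J` to `J'`. -/
structure CubeContraction (P : Finset (Fin r) ⥤ A) where
  h (K J : Finset (Fin r)) : P.obj K ⟶ P.obj J
  h_eq_zero (K J : Finset (Fin r)) : K.card ≠ J.card + 1 → h K J = 0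
  homotopy_self (J : Finset (Fin r)) :
    ∑ K, cubeEntry P J K ≫ h K J + ∑ K, h J K ≫ cubeEntry P K J = 𝟙 _
  homotopy_of_ne (J J' : Finset (Fin r)) : J ≠ J' →
    ∑ K, cubeEntry P J K ≫ h K J' + ∑ K, h J K ≫ cubeEntry P K J' = 0

/-- A direct summand of a contractible cube of objects is contractible. -/
def CubeContraction.ofRetract {P Q : Finset (Fin r) ⥤ A} (e : Retract P Q)
    (c : CubeContraction Q) : CubeContraction P := by
  have key (J J' : Finset (Fin r)) :
      ∑ K, cubeEntry P J K ≫ e.i.app K ≫ c.h K J' ≫ e.r.app J' +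
        ∑ K, (e.i.app J ≫ c.h J K ≫ e.r.app K) ≫ cubeEntry P K J' = e.i.app J ≫
      (∑ K, cubeEntry Q J K ≫ c.h K J' + ∑ K, c.h J K ≫ cubeEntry Q K J') ≫ e.r.app J' := by
    simp only [Preadditive.add_comp, Preadditive.comp_add, Preadditive.sum_comp,
      Preadditive.comp_sum, Category.assoc, ← cubeEntry_naturality,
      reassoc_of% (cubeEntry_naturality e.i)]
  exact
    { h := fun K J => e.i.app K ≫ c.h K J ≫ e.r.app J
      h_eq_zero := fun K J h => by rw [c.h_eq_zero K J h, zero_comp, comp_zero]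
      homotopy_self := fun J => by
        rw [key, c.homotopy_self, Category.id_comp, ← NatTrans.comp_app, e.retract,
          NatTrans.id_app]
      homotopy_of_ne := fun J J' h => by
        rw [key, c.homotopy_of_ne J J' h, zero_comp, comp_zero] }

end Cube

section Lift

open HomologicalComplex

variable {C : Type*} [Category* C] [Abelian C] (P : Finset (Fin r) ⥤ CochainComplex C ℤ)

instance : HasFiniteBiproducts (CochainComplex C ℤ) := Abelian.hasFiniteBiproducts

/-- The cube of objects in degree `q` of a cube of complexes. -/
def degreeCube (q : ℤ) : Finset (Fin r) ⥤ C := P ⋙ HomologicalComplex.eval C (ComplexShape.up ℤ) q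

/-- The projection of a term of the double complex to a summand, in a fixed degree. -/
def cubeπ {p : ℤ} (J : Idx r p) (q : ℤ) : ((cubeComplex P).X p).X q ⟶ (degreeCube P q).obj J.1 :=
  (biproduct.π (fun J : Idx r p => P.obj J.1) J).f q

/-- The inclusion of a summand of a term of the double complex, in a fixed degree. -/
def cubeι {p : ℤ} (J : Idx r p) (q : ℤ) : (degreeCube P q).obj J.1 ⟶ ((cubeComplex P).X p).X q :=
  (biproduct.ι (fun J : Idx r p => P.obj J.1) J).f q

lemma sum_cubeπ_cubeι (p q : ℤ) :
    ∑ J : Idx r p, cubeπ P J q ≫ cubeι P J q = 𝟙 (((cubeComplex P).X p).X q) := by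
  have h := congrArg (fun f => f.f q) (biproduct.total (f := fun J : Idx r p => P.obj J.1))
  refine Eq.trans (map_sum (Hom.fAddMonoidHom (C₁ := ⨁ fun J : Idx r p => P.obj J.1)
    (C₂ := ⨁ fun J : Idx r p => P.obj J.1) q) (fun J : Idx r p => biproduct.π _ J ≫
      biproduct.ι (fun J : Idx r p => P.obj J.1) J) Finset.univ).symm h

variable {P}

lemma hom_ext_cubeπ {p q : ℤ} {A : C} {x y : A ⟶ ((cubeComplex P).X p).X q}
    (h : ∀ J : Idx r p, x ≫ cubeπ P J q = y ≫ cubeπ P J q) : x = y := by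
  rw [← Category.comp_id x, ← Category.comp_id y, ← sum_cubeπ_cubeι, Preadditive.comp_sum,
    Preadditive.comp_sum]
  exact Finset.sum_congr rfl fun J _ => by rw [reassoc_of% (h J)]

lemma cubeEntry_f (J K : Finset (Fin r)) (q : ℤ) :
    (cubeEntry P J K).f q = cubeEntry (degreeCube P q) J K := by
  rw [cubeEntry, cubeEntry]
  split_ifs <;> rfl

lemma cubeι_comp_d_comp_cubeπ {p₀ p : ℤ} (hp : p₀ + 1 = p) (K : Idx r p₀) (J : Idx r p) (q : ℤ) :
    cubeι P K q ≫ ((cubeComplex P).d p₀ p).f q ≫ cubeπ P J q =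
      cubeEntry (degreeCube P q) K.1 J.1 := by
  rw [← cubeEntry_f, cubeComplex_d P hp]
  have h : biproduct.ι (fun J : Idx r p₀ => P.obj J.1) K ≫
      biproduct.matrix (fun (J : Idx r p₀) (K : Idx r p) => cubeEntry P J.1 K.1) ≫
      biproduct.π (fun J : Idx r p => P.obj J.1) J = cubeEntry P K.1 J.1 := by
    simp
  exact congrArg (fun f => f.f q) h

variable (P) in
/-- The augmentation of the double complex in a fixed degree. -/
def cubeε (p q : ℤ) : ((cubeComplex P).X p).X q ⟶ (degreeCube P q).obj Finset.univ :=
  (cubeAugmentation P p).f q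

lemma cubeι_comp_cubeε {p : ℤ} (K : Idx r p) (q : ℤ) :
    cubeι P K q ≫ cubeε P p q =
      cubeEntry (degreeCube P q) K.1 Finset.univ := by
  rw [← cubeEntry_f]
  exact congrArg (fun f => f.f q) (biproduct.ι_desc (f := fun J : Idx r p => P.obj J.1)
    (fun J : Idx r p => cubeEntry P J.1 Finset.univ) K)

/-- A contracting homotopy lifts the generalized elements that all components of the differential,
including those of the augmentation, annihilate. -/
lemma exists_lift_of_contraction {q : ℤ}
    (c : CubeContraction (degreeCube P q)) {p₀ p : ℤ}
    (hp : p₀ + 1 = p) {A : C} (x : A ⟶ ((cubeComplex P).X p).X q)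
    (hx : ∀ K, ∑ J : Idx r p, x ≫ cubeπ P J q ≫
      cubeEntry (degreeCube P q) J.1 K = 0) :
    ∃ y, y ≫ ((cubeComplex P).d p₀ p).f q = x := by
  refine ⟨∑ K : Idx r p₀, ∑ J : Idx r p, x ≫ cubeπ P J q ≫ c.h J.1 K.1 ≫ cubeι P K q,
    hom_ext_cubeπ fun L => ?_⟩
  simp only [Preadditive.sum_comp, Category.assoc, cubeι_comp_d_comp_cubeπ hp]
  have h₁ (J : Idx r p) : ∑ K : Idx r p₀, c.h J.1 K.1 ≫
      cubeEntry (degreeCube P q) K.1 L.1 =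
      ∑ K, c.h J.1 K ≫ cubeEntry (degreeCube P q) K L.1 := by
    refine sum_idx p₀ (fun K => c.h J.1 K ≫
      cubeEntry (degreeCube P q) K L.1)
      (fun K _ hK => ?_) fun K hK => ?_
    · have := J.1.card_le_univ
      rw [c.h_eq_zero, zero_comp]
      rw [hK, Finset.card_univ]
      omega
    · have := J.2.1
      rw [c.h_eq_zero, zero_comp]
      omega
  have h₂ (J : Idx r p) : x ≫ cubeπ P J q ≫ ∑ K, c.h J.1 K ≫
        cubeEntry (degreeCube P q) K L.1 =
      x ≫ (if J = L then cubeπ P L q else 0) - ∑ K, (x ≫ cubeπ P J q ≫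
        cubeEntry (degreeCube P q) J.1 K) ≫ c.h K L.1 := by
    rw [eq_sub_iff_add_eq']
    simp only [Category.assoc, ← Preadditive.comp_sum, ← Preadditive.comp_add]
    split_ifs with h
    · subst h
      rw [c.homotopy_self]
      simp
    · rw [c.homotopy_of_ne _ _ fun h' => h (Subtype.ext h'), comp_zero, comp_zero]
  rw [Finset.sum_comm]
  simp only [← Preadditive.comp_sum, h₁, h₂]
  rw [Finset.sum_sub_distrib, Finset.sum_comm]
  simp only [← Preadditive.sum_comp, hx]
  simp [← Preadditive.comp_sum]

lemma isZero_cubeComplex (p q : ℤ) (h : ∀ J : Idx r p, IsZero ((P.obj J.1).X q)) :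
    IsZero (((cubeComplex P).X p).X q) := by
  rw [IsZero.iff_id_eq_zero]
  exact hom_ext_cubeπ fun J => (h J).eq_of_tgt _ _

lemma isFirstQuadrant_cubeComplex (hP : ∀ J q, q < 0 → IsZero ((P.obj J).X q)) :
    HomologicalComplex₂.IsFirstQuadrant (cubeComplex P) := by
  rintro p q (hp | hq)
  · exact isZero_cubeComplex p q fun J => by
      have := J.2.1
      omega
  · exact isZero_cubeComplex p q fun J => hP J.1 q hq

lemma sum_comp_cubeEntry_eq_comp_d {p p₁ q : ℤ} (hp : p + 1 = p₁) {A : C}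
    (x : A ⟶ ((cubeComplex P).X p).X q) (K : Idx r p₁) :
    ∑ J : Idx r p, x ≫ cubeπ P J q ≫ cubeEntry (degreeCube P q) J.1 K.1 =
      x ≫ ((cubeComplex P).d p p₁).f q ≫ cubeπ P K q := by
  simp_rw [← cubeι_comp_d_comp_cubeπ hp]
  rw [← Preadditive.comp_sum]
  simp_rw [← Category.assoc (cubeπ P _ q)]
  rw [← Preadditive.sum_comp, sum_cubeπ_cubeι, Category.id_comp]

lemma sum_comp_cubeEntry_eq_comp_cubeε {p q : ℤ} {A : C}
    (x : A ⟶ ((cubeComplex P).X p).X q) :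
    ∑ J : Idx r p, x ≫ cubeπ P J q ≫ cubeEntry (degreeCube P q) J.1 Finset.univ =
      x ≫ cubeε P p q := by
  simp_rw [← cubeι_comp_cubeε]
  rw [← Preadditive.comp_sum]
  simp_rw [← Category.assoc (cubeπ P _ q)]
  rw [← Preadditive.sum_comp, sum_cubeπ_cubeι, Category.id_comp]

/-- If a cube of first quadrant complexes is degreewise contractible, then the total complex of its
proper part is quasi-isomorphic to a shift of the complex at the full set of indices. -/
theorem quasiIso_totalToShift_cubeAugmentation
    [HomologicalComplex₂.HasTotal (cubeComplex P) (ComplexShape.up ℤ)] {N : ℤ} (hN : N + 1 = r)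
    (hP : ∀ J q, q < 0 → IsZero ((P.obj J).X q))
    (c : ∀ q, CubeContraction (degreeCube P q)) :
    QuasiIso (HomologicalComplex₂.totalToShift (cubeComplex P) (cubeAugmentation P N)
      (cubeComplex_d_comp_cubeAugmentation P (by omega))) := by
  refine HomologicalComplex₂.quasiIso_totalToShift (isFirstQuadrant_cubeComplex hP) ?_ _ _ ?_ ?_ ?_
  · intro p q hp
    refine isZero_cubeComplex p q fun J => ?_
    refine (J.2.2 ((Finset.card_eq_iff_eq_univ _).mp ?_)).elim
    have h₁ := J.2.1
    have h₂ := J.1.card_le_univ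
    rw [Fintype.card_fin] at h₂ ⊢
    omega
  · intro q A b
    let b' : A ⟶ (degreeCube P q).obj Finset.univ := b
    refine ⟨∑ J : Idx r N, b' ≫ (c q).h Finset.univ J.1 ≫ cubeι P J q, ?_⟩
    have h₁ := (c q).homotopy_self Finset.univ
    rw [Finset.sum_eq_zero, zero_add] at h₁
    · rw [← sum_idx N (fun K => (c q).h Finset.univ K ≫
        cubeEntry (degreeCube P q) K Finset.univ)] at h₁
      · change _ ≫ cubeε P N q = b'
        simp only [Preadditive.sum_comp, Category.assoc, cubeι_comp_cubeε]
        rw [← Preadditive.comp_sum, h₁, Category.comp_id]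
      · intro K hK hK'
        rw [hK', Finset.card_univ, Fintype.card_fin] at hK
        omega
      · intro K hK
        rw [(c q).h_eq_zero, zero_comp]
        rw [Finset.card_univ, Fintype.card_fin]
        omega
    · intro K _
      rw [cubeEntry_of_card, zero_comp]
      have := K.card_le_univ
      rw [Finset.card_univ]
      omega
  · intro q A x hx
    refine exists_lift_of_contraction (c q) (by omega) x fun K => ?_
    by_cases hK : K = Finset.univ
    · subst hK
      rw [sum_comp_cubeEntry_eq_comp_cubeε]
      exact hx
    · refine Finset.sum_eq_zero fun J _ => ?_
      rw [cubeEntry_of_card, comp_zero, comp_zero]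
      intro h
      refine hK ((Finset.card_eq_iff_eq_univ _).mp ?_)
      have := J.2.1
      rw [Fintype.card_fin]
      omega
  · intro p₀ p p₁ q hp hp₁ hpN A x hx
    refine exists_lift_of_contraction (c q) hp x fun K => ?_
    by_cases hK : (K.card : ℤ) = p₁
    · have hK' : K ≠ Finset.univ := by
        rintro rfl
        rw [Finset.card_univ, Fintype.card_fin] at hK
        omega
      rw [sum_comp_cubeEntry_eq_comp_d hp₁ x ⟨K, hK, hK'⟩, reassoc_of% hx, zero_comp]
    · refine Finset.sum_eq_zero fun J _ => ?_
      rw [cubeEntry_of_card, comp_zero, comp_zero]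
      have := J.2.1
      omega

end Lift

end CechComplement

/-! ### Contraction of the cube of sheaves of sections over open subspaces -/

namespace CechComplement

open Opposite

variable {X : TopCat.{u}} {r : ℕ}

/-- The functor `j_* j^*` for the inclusion `j` of an open subspace `W`. -/
def loc (W : Opens X) : Sh X ⥤ Sh X := restr W ⋙ push W.inclusion'

/-- The open set `O ∩ W`, in the form in which it occurs in the sections of `j_* j^* F`. -/
abbrev locOpen (W O : Opens X) : Opens X :=
  W.isOpenEmbedding.isOpenMap.functor.obj ((Opens.map W.inclusion').obj O)

lemma mem_locOpen {W O : Opens X} {x : X} : x ∈ locOpen W O ↔ x ∈ O ∧ x ∈ W := by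
  constructor
  · rintro ⟨y, hy, rfl⟩
    exact ⟨hy, y.2⟩
  · rintro ⟨h, h'⟩
    exact ⟨⟨x, h'⟩, h, rfl⟩

lemma locOpen_mono {V W : Opens X} (h : V ≤ W) (O : Opens X) : locOpen V O ≤ locOpen W O :=
  fun _ hx => mem_locOpen.mpr ⟨(mem_locOpen.mp hx).1, h (mem_locOpen.mp hx).2⟩

/-- The restriction morphism `j_{W*} j_W^* ⟶ j_{V*} j_V^*` for `V ≤ W`. -/
def locMap {V W : Opens X} (h : V ≤ W) : loc W ⟶ loc V where
  app F := ⟨{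
    app := fun O => F.obj.map (homOfLE (locOpen_mono h O.unop)).op
    naturality := fun O O' i => by
      change F.obj.map _ ≫ F.obj.map _ = F.obj.map _ ≫ F.obj.map _
      rw [← F.obj.map_comp, ← F.obj.map_comp]
      rfl }⟩
  naturality F G f := by
    apply CategoryTheory.Sheaf.hom_ext
    apply NatTrans.ext
    funext O
    exact (f.hom.naturality (homOfLE (locOpen_mono h O.unop)).op).symm

lemma locMap_comp {V W W' : Opens X} (h : V ≤ W) (h' : W ≤ W') :
    locMap h' ≫ locMap h = locMap (h.trans h') := by
  ext F : 2
  apply CategoryTheory.Sheaf.hom_ext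
  apply NatTrans.ext
  funext O
  exact (F.obj.map_comp _ _).symm

lemma locMap_refl (W : Opens X) : locMap (le_refl W) = 𝟙 _ := by
  ext F : 2
  apply CategoryTheory.Sheaf.hom_ext
  apply NatTrans.ext
  funext O
  exact F.obj.map_id _

instance (W : Opens X) : (loc W).Additive where

/-- The cube of functors `j_* j^*` for an antitone family of open sets. -/
def locCube (V : Finset (Fin r) → Opens X) (hV : Antitone V) : Finset (Fin r) ⥤ Sh X ⥤ Sh X where
  obj J := loc (V J)
  map f := locMap (hV f.le)
  map_id _ := locMap_refl _
  map_comp _ _ := (locMap_comp _ _).symm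

section Mult

variable (V : X → CVect.{u})

open Classical in
/-- The value at a point `x` of `W'` of the multiplication of discontinuous sections on `W` by an
integer valued function, with the value `0` if `x` is not in `W`. -/
def locMultAt (W W' : Opens X) (c : X → ℤ) (O : Opens X) (x : locOpen W' O) :
    (∀ y : locOpen W O, V y) →ₗ[ULift.{u} ℂ] V x :=
  if hx : x.1 ∈ W then
    c x.1 • LinearMap.proj (φ := fun y : locOpen W O => V y.1)
      (⟨x.1, mem_locOpen.mpr ⟨(mem_locOpen.mp x.2).1, hx⟩⟩ : locOpen W O)
  else 0

/-- Multiplication of discontinuous sections on `W` by an integer valued function, followed by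
extension by zero from `W` to `W'`. -/
def locMult (W W' : Opens X) (c : X → ℤ) :
    (loc W).obj (discontinuousSections V) ⟶ (loc W').obj (discontinuousSections V) :=
  ⟨{ app := fun O => ModuleCat.ofHom (LinearMap.pi (locMultAt V W W' c O.unop))
     naturality := fun O O' i => by
      apply ModuleCat.hom_ext
      apply LinearMap.ext
      intro s
      funext x
      have hO : locOpen W O'.unop ≤ locOpen W O.unop := fun y hy =>
        mem_locOpen.mpr ⟨i.unop.le (mem_locOpen.mp hy).1, (mem_locOpen.mp hy).2⟩
      have hx' : x.1 ∈ locOpen W' O.unop :=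
        mem_locOpen.mpr ⟨i.unop.le (mem_locOpen.mp x.2).1, (mem_locOpen.mp x.2).2⟩
      change locMultAt V W W' c O'.unop x
          (fun y : locOpen W O'.unop => (s : ∀ y : locOpen W O.unop, V y) ⟨y.1, hO y.2⟩) =
        locMultAt V W W' c O.unop ⟨x.1, hx'⟩ s
      by_cases hx : x.1 ∈ W
      · rw [locMultAt, locMultAt, dif_pos hx, dif_pos hx]
        rfl
      · rw [locMultAt, locMultAt, dif_neg hx, dif_neg hx]
        rfl }⟩

/-- The value at a point of a section of `j_* j^*` of a sheaf of discontinuous sections. -/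
def locEval (W O : Opens X) (x : locOpen W O) :
    ((loc W).obj (discontinuousSections V)).obj.obj (op O) ⟶ V x.1 :=
  ModuleCat.ofHom (LinearMap.proj x)

variable {V}

lemma hom_ext_locEval {F : Sh X} {W : Opens X} {f g : F ⟶ (loc W).obj (discontinuousSections V)}
    (h : ∀ (O : Opens X) (x : locOpen W O),
      f.hom.app (op O) ≫ locEval V W O x = g.hom.app (op O) ≫ locEval V W O x) : f = g := by
  apply CategoryTheory.Sheaf.hom_ext
  apply NatTrans.ext
  funext O
  apply ModuleCat.hom_ext
  apply LinearMap.ext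
  intro s
  funext x
  exact congrArg (fun φ => φ.hom s) (h O.unop x)

lemma locMult_locEval (W W' : Opens X) (c : X → ℤ) (O : Opens X) (x : locOpen W' O)
    (hx : x.1 ∈ W) : (locMult V W W' c).hom.app (op O) ≫ locEval V W' O x =
      c x.1 • locEval V W O ⟨x.1, mem_locOpen.mpr ⟨(mem_locOpen.mp x.2).1, hx⟩⟩ := by
  apply ModuleCat.hom_ext
  apply LinearMap.ext
  intro s
  refine congrArg (fun φ : _ →ₗ[ULift.{u} ℂ] _ => φ s) (dif_pos hx)

lemma locMult_locEval_of_notMem (W W' : Opens X) (c : X → ℤ) (O : Opens X) (x : locOpen W' O)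
    (hx : x.1 ∉ W) : (locMult V W W' c).hom.app (op O) ≫ locEval V W' O x = 0 := by
  apply ModuleCat.hom_ext
  apply LinearMap.ext
  intro s
  refine congrArg (fun φ : _ →ₗ[ULift.{u} ℂ] _ => φ s) (dif_neg hx)

lemma locMult_comp (W W' W'' : Opens X) (c c' d : X → ℤ)
    (h : ∀ x ∈ W, x ∈ W'' → x ∈ W' → d x = c x * c' x)
    (h' : ∀ x ∈ W, x ∈ W'' → x ∉ W' → d x = 0) :
    locMult V W W' c ≫ locMult V W' W'' c' = locMult V W W'' d := by
  apply hom_ext_locEval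
  intro O x
  have hx := mem_locOpen.mp x.2
  change ((locMult V W W' c).hom.app (op O) ≫ (locMult V W' W'' c').hom.app (op O)) ≫ _ = _
  rw [Category.assoc]
  by_cases h₁ : x.1 ∈ W'
  · rw [locMult_locEval _ _ _ _ _ h₁, Preadditive.comp_zsmul]
    by_cases h₂ : x.1 ∈ W
    · rw [locMult_locEval _ _ _ _ _ h₂, locMult_locEval W W' c O ⟨x.1, _⟩ h₂, smul_smul,
        h x.1 h₂ hx.2 h₁, mul_comm]
    · rw [locMult_locEval_of_notMem _ _ _ _ _ h₂,
        locMult_locEval_of_notMem W W' c O ⟨x.1, _⟩ h₂, smul_zero]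
  · rw [locMult_locEval_of_notMem _ _ _ _ _ h₁, comp_zero]
    by_cases h₂ : x.1 ∈ W
    · rw [locMult_locEval _ _ _ _ _ h₂, h' x.1 h₂ hx.2 h₁, zero_smul]
    · rw [locMult_locEval_of_notMem _ _ _ _ _ h₂]

lemma locMult_add (W W' : Opens X) (c c' : X → ℤ) :
    locMult V W W' c + locMult V W W' c' = locMult V W W' (c + c') := by
  apply hom_ext_locEval
  intro O x
  change ((locMult V W W' c).hom.app (op O) + (locMult V W W' c').hom.app (op O)) ≫ _ = _
  rw [Preadditive.add_comp]
  by_cases h₂ : x.1 ∈ W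
  · simp only [locMult_locEval _ _ _ _ _ h₂, Pi.add_apply, add_smul]
  · simp only [locMult_locEval_of_notMem _ _ _ _ _ h₂, add_zero]

lemma locMult_congr (W W' : Opens X) {c c' : X → ℤ} (h : ∀ x ∈ W, x ∈ W' → c x = c' x) :
    locMult V W W' c = locMult V W W' c' := by
  apply hom_ext_locEval
  intro O x
  by_cases h₂ : x.1 ∈ W
  · rw [locMult_locEval _ _ _ _ _ h₂, locMult_locEval _ _ _ _ _ h₂,
      h x.1 h₂ (mem_locOpen.mp x.2).2]
  · rw [locMult_locEval_of_notMem _ _ _ _ _ h₂, locMult_locEval_of_notMem _ _ _ _ _ h₂]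

lemma locMult_zero (W W' : Opens X) : locMult V W W' 0 = 0 := by
  have h := locMult_add (V := V) W W' 0 0
  rw [add_zero] at h
  exact add_eq_left.mp h

lemma locMult_sum {ι : Type*} (s : Finset ι) (W W' : Opens X) (c : ι → X → ℤ) :
    ∑ i ∈ s, locMult V W W' (c i) = locMult V W W' (∑ i ∈ s, c i) := by
  classical
  induction s using Finset.induction_on with
  | empty => simp [locMult_zero]
  | insert a s ha ih => rw [Finset.sum_insert ha, Finset.sum_insert ha, ih, locMult_add]

lemma locMult_one (W : Opens X) : locMult V W W 1 = 𝟙 _ := by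
  apply hom_ext_locEval
  intro O x
  rw [locMult_locEval _ _ _ _ _ (mem_locOpen.mp x.2).2, Pi.one_apply, one_smul]
  rfl

lemma smul_locMap_app {W W' : Opens X} (h : W' ≤ W) (n : ℤ) :
    n • (locMap h).app (discontinuousSections V) = locMult V W W' fun _ => n := by
  apply hom_ext_locEval
  intro O x
  rw [locMult_locEval _ _ _ _ _ (h (mem_locOpen.mp x.2).2)]
  rfl

end Mult

/-- If every point `x` has a vertex `k x` such that adding `k x` to `J` does not remove `x` from the
open set `V J`, then the cube of the sheaves `j_* j^*` of discontinuous sections is contractible: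
over the point `x`, the vertex `k x` is used for the contraction. -/
def locCubeContraction (V : Finset (Fin r) → Opens X) (hV : Antitone V) (k : X → Fin r)
    (hk : ∀ x J, x ∈ V J → k x ∉ J → x ∈ V (insert (k x) J)) (T : X → CVect.{u}) :
    CubeContraction ((locCube V hV).flip.obj (discontinuousSections T)) := by
  have hd (J K : Finset (Fin r)) : cubeEntry ((locCube V hV).flip.obj (discontinuousSections T))
      J K = locMult T (V J) (V K) fun _ => incidence J K := by
    by_cases h : J ≤ K
    · rw [cubeEntry_of_le _ h]
      exact smul_locMap_app (hV h) _
    · rw [cubeEntry, dif_neg h, incidence_of_not_le h]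
      exact (locMult_zero _ _).symm
  let H (K J : Finset (Fin r)) : ((locCube V hV).flip.obj (discontinuousSections T)).obj K ⟶
    ((locCube V hV).flip.obj (discontinuousSections T)).obj J :=
      locMult T (V K) (V J) fun x => contraction (k x) K J
  have key (J J' : Finset (Fin r)) :
      ∑ K, cubeEntry ((locCube V hV).flip.obj (discontinuousSections T)) J K ≫ H K J' +
        ∑ K, H J K ≫ cubeEntry ((locCube V hV).flip.obj (discontinuousSections T)) K J' =
      locMult T (V J) (V J') fun _ => if J = J' then 1 else 0 := by
    have h₁ (K : Finset (Fin r)) :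
        cubeEntry ((locCube V hV).flip.obj (discontinuousSections T)) J K ≫ H K J' =
        locMult T (V J) (V J') fun x => incidence J K * contraction (k x) K J' := by
      rw [hd]
      refine locMult_comp _ _ _ _ _ _ (fun _ _ _ _ => rfl) fun x _ hx hx' => ?_
      by_contra h
      obtain ⟨h₁, rfl⟩ := of_contraction_ne_zero (right_ne_zero_of_mul h)
      exact hx' (hk x J' hx h₁)
    have h₂ (K : Finset (Fin r)) :
        H J K ≫ cubeEntry ((locCube V hV).flip.obj (discontinuousSections T)) K J' =
        locMult T (V J) (V J') fun x => contraction (k x) J K * incidence K J' := by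
      rw [hd]
      refine locMult_comp _ _ _ _ _ _ (fun _ _ _ _ => rfl) fun x hx _ hx' => ?_
      by_contra h
      obtain ⟨h₁, rfl⟩ := of_contraction_ne_zero (left_ne_zero_of_mul h)
      exact hx' (hV (Finset.subset_insert _ _) hx)
    refine (congrArg₂ (· + ·)
      ((Finset.sum_congr rfl fun K _ => h₁ K).trans (locMult_sum _ _ _ _))
      ((Finset.sum_congr rfl fun K _ => h₂ K).trans (locMult_sum _ _ _ _))).trans
        ((locMult_add _ _ _ _).trans (congrArg _ ?_))
    funext x
    simp only [Pi.add_apply, Finset.sum_apply]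
    exact contraction_homotopy (k x) J J'
  exact
    { h := H
      h_eq_zero := fun K J h => by
        refine Eq.trans (locMult_congr (c' := 0) _ _ fun x _ _ => ?_) (locMult_zero _ _)
        by_contra h'
        obtain ⟨h₁, rfl⟩ := of_contraction_ne_zero h'
        exact h (Finset.card_insert_of_notMem h₁)
      homotopy_self := fun J => by
        rw [key]
        simp only [if_true]
        exact locMult_one _
      homotopy_of_ne := fun J J' h => by
        rw [key, if_neg h]
        exact locMult_zero _ _ }

/-- The contraction for sheaves of discontinuous sections passes to injective sheaves, which are
direct summands of such sheaves. -/
lemma nonempty_locCubeContraction (V : Finset (Fin r) → Opens X) (hV : Antitone V) (k : X → Fin r)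
    (hk : ∀ x J, x ∈ V J → k x ∉ J → x ∈ V (insert (k x) J)) (F : Sh X) [Injective F] :
    Nonempty (CubeContraction ((locCube V hV).flip.obj F)) := by
  obtain ⟨e⟩ := nonempty_retract_discontinuousSections F
  exact ⟨.ofRetract (e.map (locCube V hV).flip) (locCubeContraction V hV k hk _)⟩

end CechComplement

/-! ### Resolutions of constant sheaves and direct images -/

namespace CechComplement

open Opposite

/-- Morphisms out of the constant sheaf are vectors of global sections. -/
def constHom {Y : TopCat.{u}} (F : Sh Y) : (constSheaf Y ⟶ F) ≃
    (ModuleCat.of (ULift.{u} ℂ) (ULift.{u} ℂ) ⟶ F.obj.obj (op ⊤)) :=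
  (constantSheafAdj (Opens.grothendieckTopology Y) CVect.{u}
    (isTerminalTop (α := Opens Y))).homEquiv _ F

lemma constHom_comp {Y : TopCat.{u}} {F G : Sh Y} (f : constSheaf Y ⟶ F) (g : F ⟶ G) :
    constHom G (f ≫ g) = constHom F f ≫ g.hom.app (op ⊤) :=
  (constantSheafAdj (Opens.grothendieckTopology Y) CVect.{u}
    (isTerminalTop (α := Opens Y))).homEquiv_naturality_right f g

lemma constHom_constToPush {Y Z : TopCat.{u}} (f : Y ⟶ Z) :
    constHom ((push f).obj (constSheaf Y)) (constToPush f) = constHom (constSheaf Y) (𝟙 _) :=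
  (Equiv.apply_symm_apply _ _).trans (Adjunction.homEquiv_id _ _).symm

lemma constHom_constToPush_comp {Y Z : TopCat.{u}} (f : Y ⟶ Z) {F : Sh Y}
    (g : constSheaf Y ⟶ F) :
    constHom ((push f).obj F) (constToPush f ≫ (push f).map g) = constHom F g := by
  rw [constHom_comp, constHom_constToPush]
  exact (constHom_comp (𝟙 _) g).symm.trans (by rw [Category.id_comp])

/-- If `L` is left adjoint to `f_*`, then the morphism `L ℂ_Z ⟶ ℂ_Y` adjoint to
`ℂ_Z ⟶ f_* ℂ_Y` is an isomorphism: both sheaves represent the functor of global sections. -/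
lemma isIso_homEquiv_symm_constToPush {Y Z : TopCat.{u}} (f : Y ⟶ Z) {L : Sh Z ⥤ Sh Y}
    (adj : L ⊣ push f) : IsIso ((adj.homEquiv _ _).symm (constToPush f)) := by
  rw [isIso_iff_coyoneda_map_bijective]
  intro F
  have h : (fun g : constSheaf Y ⟶ F => (adj.homEquiv _ _).symm (constToPush f) ≫ g) =
      ((constHom F).trans ((constHom ((push f).obj F)).symm.trans (adj.homEquiv _ F).symm)) := by
    funext g
    rw [← Adjunction.homEquiv_naturality_right_symm]
    exact congrArg (adj.homEquiv _ F).symm (((constHom _).symm_apply_apply _).symm.trans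
      (congrArg (constHom _).symm (constHom_constToPush_comp f g)))
  rw [h]
  exact Equiv.bijective _

lemma constToPush_comp {Y Z T : TopCat.{u}} (f : Y ⟶ Z) (g : Z ⟶ T) :
    constToPush g ≫ (push g).map (constToPush f) = constToPush (f ≫ g) := by
  apply (constHom _).injective
  refine (constHom_constToPush_comp g (constToPush f)).trans ?_
  exact (constHom_constToPush f).trans (constHom_constToPush (f ≫ g)).symm

variable {X : TopCat.{u}}

lemma constToPush_constRestrict {V W : Opens X} (h : V ≤ W) :
    constToPush W.inclusion' ≫ constRestrict h = constToPush V.inclusion' :=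
  constToPush_comp ((Opens.toTopCat X).map (homOfLE h)) W.inclusion'

/-- The direct image along the identity is the identity functor. -/
def pushId (Y : TopCat.{u}) : 𝟭 (Sh Y) ≅ push (𝟙 Y) :=
  NatIso.ofComponents (fun _ => Iso.refl _) fun _ => rfl

/-- The direct image along a homeomorphism is an equivalence. -/
lemma isEquivalence_push {Y Z : TopCat.{u}} (e : Y ≅ Z) : (push e.hom).IsEquivalence :=
  (CategoryTheory.Equivalence.mk (push e.hom) (push e.inv)
    ((pushId Y).trans (eqToIso (congrArg push e.hom_inv_id.symm)))
    ((eqToIso (congrArg push e.inv_hom_id)).trans (pushId Z).symm)).isEquivalence_functor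

lemma isEquivalence_push_of_eq_top {W : Opens X} (hW : W = ⊤) :
    (push W.inclusion').IsEquivalence := by
  subst hW
  exact isEquivalence_push (Opens.inclusionTopIso X)

lemma isIso_constToPush_of_eq_top {W : Opens X} (hW : W = ⊤) :
    IsIso (constToPush W.inclusion') := by
  have := isEquivalence_push_of_eq_top hW
  have h := isIso_homEquiv_symm_constToPush W.inclusion' (restrAdj W)
  have e := ((restrAdj W).homEquiv _ _).apply_symm_apply (constToPush W.inclusion')
  have : (restr W).IsEquivalence := (restrAdj W).isEquivalence_left_of_isEquivalence_right
  rw [← e, Adjunction.homEquiv_unit]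
  have h₁ : IsIso ((restrAdj W).unit.app (constSheaf X)) := inferInstance
  have h₂ := Functor.map_isIso (push W.inclusion')
    (((restrAdj W).homEquiv _ _).symm (constToPush W.inclusion'))
  exact @IsIso.comp_isIso _ _ _ _ _ _ _ h₁ h₂

section Transpose

variable {W : Opens X} {L : CochainComplex (Sh X) ℤ}
  {R : CochainComplex (Sh ((Opens.toTopCat X).obj W)) ℤ}

/-- The morphism of complexes `j^* L ⟶ R` that is adjoint to a morphism `L ⟶ j_* R`. -/
def transpose (f : L ⟶ (pushComplex W.inclusion').obj R) :
    ((restr W).mapHomologicalComplex (ComplexShape.up ℤ)).obj L ⟶ R where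
  f n := ((restrAdj W).homEquiv _ _).symm (f.f n)
  comm' i j _ := by
    have h : f.f i ≫ (push W.inclusion').map (R.d i j) = L.d i j ≫ f.f j := f.comm i j
    exact ((restrAdj W).homEquiv_naturality_right_symm (f.f i) (R.d i j)).symm.trans
      ((congrArg ((restrAdj W).homEquiv _ _).symm h).trans
        ((restrAdj W).homEquiv_naturality_left_symm (L.d i j) (f.f j)))

end Transpose

/-- A morphism between complexes that are quasi-isomorphic to isomorphic objects, compatible with
this isomorphism, is a quasi-isomorphism. -/
lemma quasiIso_of_comp_eq_single {C : Type*} [Category* C] [Abelian C] {F F' : C}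
    {L L' : CochainComplex C ℤ} (φ : L ⟶ L')
    (α : (HomologicalComplex.single C (ComplexShape.up ℤ) 0).obj F ⟶ L)
    (α' : (HomologicalComplex.single C (ComplexShape.up ℤ) 0).obj F' ⟶ L')
    (t : F ⟶ F') [IsIso t] (hα : QuasiIso α) (hα' : QuasiIso α')
    (h : α ≫ φ = (HomologicalComplex.single C (ComplexShape.up ℤ) 0).map t ≫ α') :
    QuasiIso φ := by
  have : QuasiIso (α ≫ φ) := by rw [h]; infer_instance
  exact quasiIso_of_comp_left α φ

/-- The image of a morphism from an object to a complex under an additive functor. -/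
def mapFromSingle {C D : Type*} [Category* C] [Abelian C] [Category* D] [Abelian D] (G : C ⥤ D)
    [G.Additive] {F : C} {L : CochainComplex C ℤ}
    (α : (HomologicalComplex.single C (ComplexShape.up ℤ) 0).obj F ⟶ L) :
    (HomologicalComplex.single D (ComplexShape.up ℤ) 0).obj (G.obj F) ⟶
      (G.mapHomologicalComplex (ComplexShape.up ℤ)).obj L :=
  (HomologicalComplex.singleMapHomologicalComplex G (ComplexShape.up ℤ) 0).inv.app F ≫
    (G.mapHomologicalComplex (ComplexShape.up ℤ)).map α

/-- The morphism in degree `0` that determines a morphism from an object to a complex. -/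
def zeroPart {C : Type*} [Category* C] [Abelian C] {F : C} {L : CochainComplex C ℤ}
    (α : (HomologicalComplex.single C (ComplexShape.up ℤ) 0).obj F ⟶ L) : F ⟶ L.X 0 :=
  (HomologicalComplex.singleObjXSelf (ComplexShape.up ℤ) 0 F).inv ≫ α.f 0

lemma zeroPart_injective {C : Type*} [Category* C] [Abelian C] {F : C} {L : CochainComplex C ℤ}
    {α β : (HomologicalComplex.single C (ComplexShape.up ℤ) 0).obj F ⟶ L}
    (h : zeroPart α = zeroPart β) : α = β :=
  HomologicalComplex.from_single_hom_ext ((cancel_epi _).mp h)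

lemma zeroPart_comp {C : Type*} [Category* C] [Abelian C] {F : C} {L L' : CochainComplex C ℤ}
    (α : (HomologicalComplex.single C (ComplexShape.up ℤ) 0).obj F ⟶ L) (φ : L ⟶ L') :
    zeroPart (α ≫ φ) = zeroPart α ≫ φ.f 0 := by
  simp [zeroPart]

lemma zeroPart_single_map_comp {C : Type*} [Category* C] [Abelian C] {F F' : C}
    {L : CochainComplex C ℤ} (t : F ⟶ F')
    (α : (HomologicalComplex.single C (ComplexShape.up ℤ) 0).obj F' ⟶ L) :
    zeroPart ((HomologicalComplex.single C (ComplexShape.up ℤ) 0).map t ≫ α) =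
      t ≫ zeroPart α := by
  simp [zeroPart, HomologicalComplex.single_map_f_self]

lemma zeroPart_mapFromSingle {C D : Type*} [Category* C] [Abelian C] [Category* D] [Abelian D]
    (G : C ⥤ D) [G.Additive] {F : C} {L : CochainComplex C ℤ}
    (α : (HomologicalComplex.single C (ComplexShape.up ℤ) 0).obj F ⟶ L) :
    zeroPart (mapFromSingle G α) = G.map (zeroPart α) := by
  have h : (mapFromSingle G α).f 0 =
      (HomologicalComplex.singleObjXSelf (ComplexShape.up ℤ) 0 (G.obj F)).hom ≫
        G.map (zeroPart α) := by
    refine (congrArg (· ≫ G.map (α.f 0))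
      (HomologicalComplex.singleMapHomologicalComplex_inv_app_self G (ComplexShape.up ℤ) 0 F)).trans
      ((Category.assoc _ _ _).trans ?_)
    rw [zeroPart, G.map_comp]
  exact (congrArg (_ ≫ ·) h).trans (Iso.inv_hom_id_assoc _ _)

lemma quasiIso_mapFromSingle {C D : Type*} [Category* C] [Abelian C] [Category* D] [Abelian D]
    (G : C ⥤ D) [G.Additive] [PreservesFiniteLimits G] [PreservesFiniteColimits G] {F : C}
    {L : CochainComplex C ℤ}
    (α : (HomologicalComplex.single C (ComplexShape.up ℤ) 0).obj F ⟶ L) (hα : QuasiIso α) :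
    QuasiIso (mapFromSingle G α) := by
  rw [mapFromSingle]
  infer_instance

/-- The source of `K.ι'` is written with `CochainComplex.singleFunctor` in Mathlib, and here with the
definitionally equal `HomologicalComplex.single`. -/
lemma quasiIso_injectiveResolution {C : Type*} [Category* C] [Abelian C] {F : C}
    (K : InjectiveResolution F) :
    QuasiIso (K := (HomologicalComplex.single C (ComplexShape.up ℤ) 0).obj F) K.ι' :=
  inferInstanceAs (QuasiIso K.ι')

end CechComplement

/-! ### Restrictions of the global resolution -/

namespace CechComplement

open Opposite

variable {X : TopCat.{u}}

section LocComplex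

lemma unit_comp_locMap {V W : Opens X} (h : V ≤ W) (F : Sh X) :
    (restrAdj W).unit.app F ≫ (locMap h).app F = (restrAdj V).unit.app F := by
  apply CategoryTheory.Sheaf.hom_ext
  apply NatTrans.ext
  funext O
  exact (F.obj.map_comp _ _).symm

/-- A morphism from `j_{W*} j_W^* F` to a sheaf supported on a smaller open set `V` is determined
by its composition with the unit `F ⟶ j_{W*} j_W^* F`, since its values on `O` and on `O ∩ W`
agree. -/
lemma hom_ext_of_unit_comp {V W : Opens X} (h : V ≤ W) {F : Sh X}
    {G : Sh ((Opens.toTopCat X).obj V)} {φ ψ : (loc W).obj F ⟶ (push V.inclusion').obj G}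
    (e : (restrAdj W).unit.app F ≫ φ = (restrAdj W).unit.app F ≫ ψ) : φ = ψ := by
  apply CategoryTheory.Sheaf.hom_ext
  apply NatTrans.ext
  funext O
  let i : locOpen W O.unop ⟶ O.unop := homOfLE fun _ hx => (mem_locOpen.mp hx).1
  let k : (Opens.map V.inclusion').obj O.unop ⟶ (Opens.map V.inclusion').obj (locOpen W O.unop) :=
    homOfLE fun x hx => mem_locOpen.mpr ⟨hx, h x.2⟩
  have hk : G.obj.map ((Opens.map V.inclusion').map i).op ≫ G.obj.map k.op = 𝟙 _ :=
    (G.obj.map_comp _ _).symm.trans (G.obj.map_id _)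
  have key (φ : (loc W).obj F ⟶ (push V.inclusion').obj G) :
      φ.hom.app O = ((restrAdj W).unit.app F ≫ φ).hom.app (op (locOpen W O.unop)) ≫
        G.obj.map k.op := by
    have hn := φ.hom.naturality i.op
    refine Eq.trans ?_ (congrArg (· ≫ G.obj.map k.op) hn.symm)
    exact ((Category.assoc _ _ _).trans ((congrArg (φ.hom.app O ≫ ·) hk).trans
      (Category.comp_id _))).symm
  rw [key φ, key ψ, e]

/-- Taking adjoints is compatible with a morphism `ρ : j_{W*} G ⟶ j_{V*} G'` that need not come from a
morphism over `V`: both sides agree with `f ≫ ρ` after composition with the unit. -/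
lemma push_map_homEquiv_symm_comp {V W : Opens X} (h : V ≤ W) {F : Sh X}
    {G : Sh ((Opens.toTopCat X).obj W)} {G' : Sh ((Opens.toTopCat X).obj V)}
    (f : F ⟶ (push W.inclusion').obj G)
    (ρ : (push W.inclusion').obj G ⟶ (push V.inclusion').obj G')
    (g : F ⟶ (push V.inclusion').obj G') (e : f ≫ ρ = g) :
    (push W.inclusion').map (((restrAdj W).homEquiv _ _).symm f) ≫ ρ =
      (locMap h).app F ≫ (push V.inclusion').map (((restrAdj V).homEquiv _ _).symm g) := by
  apply hom_ext_of_unit_comp h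
  have h₁ : (restrAdj W).unit.app F ≫
      (push W.inclusion').map (((restrAdj W).homEquiv _ _).symm f) = f :=
    ((restrAdj W).homEquiv_unit _ _ _).symm.trans (Equiv.apply_symm_apply _ _)
  have h₂ : (restrAdj V).unit.app F ≫
      (push V.inclusion').map (((restrAdj V).homEquiv _ _).symm g) = g :=
    ((restrAdj V).homEquiv_unit _ _ _).symm.trans (Equiv.apply_symm_apply _ _)
  refine ((Category.assoc _ _ _).symm.trans (congrArg (· ≫ ρ) h₁)).trans (e.trans ?_)
  exact (((Category.assoc _ _ _).symm.trans (congrArg (· ≫ _) (unit_comp_locMap h F))).trans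
    h₂).symm

/-- The complex `j^* L` on an open subspace. -/
abbrev restrComplex (W : Opens X) (L : CochainComplex (Sh X) ℤ) :
    CochainComplex (Sh ((Opens.toTopCat X).obj W)) ℤ :=
  ((restr W).mapHomologicalComplex (ComplexShape.up ℤ)).obj L

/-- The complex `j_* j^* L`. -/
abbrev locComplex (W : Opens X) (L : CochainComplex (Sh X) ℤ) : CochainComplex (Sh X) ℤ :=
  (pushComplex W.inclusion').obj (restrComplex W L)

/-- The restriction morphism `j_{W*} j_W^* L ⟶ j_{V*} j_V^* L` of complexes for `V ≤ W`. -/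
def locComplexMap {V W : Opens X} (h : V ≤ W) (L : CochainComplex (Sh X) ℤ) :
    locComplex W L ⟶ locComplex V L where
  f n := (locMap h).app (L.X n)
  comm' i j _ := ((locMap h).naturality (L.d i j)).symm

lemma locComplexMap_comp {V W W' : Opens X} (h : V ≤ W) (h' : W ≤ W')
    (L : CochainComplex (Sh X) ℤ) :
    locComplexMap h' L ≫ locComplexMap h L = locComplexMap (h.trans h') L := by
  apply HomologicalComplex.hom_ext
  intro n
  exact congrArg (fun α => α.app (L.X n)) (locMap_comp h h')

lemma locComplexMap_refl (W : Opens X) (L : CochainComplex (Sh X) ℤ) :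
    locComplexMap (le_refl W) L = 𝟙 _ := by
  apply HomologicalComplex.hom_ext
  intro n
  exact congrArg (fun α => α.app (L.X n)) (locMap_refl W)

lemma isIso_locComplexMap {V W : Opens X} (h : V ≤ W) (h' : W ≤ V)
    (L : CochainComplex (Sh X) ℤ) : IsIso (locComplexMap h L) :=
  ⟨locComplexMap h' L, (locComplexMap_comp h' h L).trans (locComplexMap_refl W L),
    (locComplexMap_comp h h' L).trans (locComplexMap_refl V L)⟩

lemma pushComplex_map_transpose_comp {V W : Opens X} (h : V ≤ W) {L : CochainComplex (Sh X) ℤ}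
    {R : CochainComplex (Sh ((Opens.toTopCat X).obj W)) ℤ}
    {R' : CochainComplex (Sh ((Opens.toTopCat X).obj V)) ℤ}
    (f : L ⟶ (pushComplex W.inclusion').obj R)
    (ρ : (pushComplex W.inclusion').obj R ⟶ (pushComplex V.inclusion').obj R')
    (g : L ⟶ (pushComplex V.inclusion').obj R') (e : f ≫ ρ = g) :
    (pushComplex W.inclusion').map (transpose f) ≫ ρ =
      locComplexMap h L ≫ (pushComplex V.inclusion').map (transpose g) := by
  apply HomologicalComplex.hom_ext
  intro n
  exact push_map_homEquiv_symm_comp h (f.f n) (ρ.f n) (g.f n) (congrArg (fun φ => φ.f n) e)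

variable {L : CochainComplex (Sh X) ℤ} [L.IsStrictlyGE 0]

/-- The functor `j_*` preserves quasi-isomorphisms between bounded below complexes of injective
sheaves; in particular it turns a quasi-isomorphism `j^* L ⟶ R` into one with source `j_* j^* L`. -/
lemma quasiIso_locComplexMap_comp {V W : Opens X} (h : V ≤ W) (h' : W ≤ V)
    [∀ n, Injective (L.X n)] {R : CochainComplex (Sh ((Opens.toTopCat X).obj V)) ℤ}
    [R.IsKInjective] (f : restrComplex V L ⟶ R) (hf : QuasiIso f) :
    QuasiIso (locComplexMap h L ≫ (pushComplex V.inclusion').map f) := by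
  have : (restrComplex V L).IsStrictlyGE 0 := inferInstance
  have (n : ℤ) : Injective ((restrComplex V L).X n) := injective_restr V (L.X n)
  have : (restrComplex V L).IsKInjective := CochainComplex.isKInjective_of_injective _ 0
  have := isIso_locComplexMap h h' L
  have := CochainComplex.quasiIso_mapHomologicalComplex_map_of_isKInjective
    (push V.inclusion') f hf
  infer_instance

end LocComplex

section Resolution

variable {r : ℕ} {U : Fin r → Opens X} (S : ResolutionSystem U)

/-- The direct image of the resolution over the union of all `U_k`. Since the `U_k` cover the space,
it is a resolution of the constant sheaf on the whole space. -/
abbrev ResolutionSystem.global : CochainComplex (Sh X) ℤ := derivedPush (S.res Finset.univ)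

instance (n : ℤ) : Injective (S.global.X n) :=
  injective_push _ ((S.res Finset.univ).cochainComplex.X n)

/-- The coaugmentation of the resolution `S.global` of the constant sheaf. -/
def coaugmentation : (HomologicalComplex.single (Sh X) (ComplexShape.up ℤ) 0).obj (constSheaf X) ⟶
    S.global :=
  (HomologicalComplex.single (Sh X) (ComplexShape.up ℤ) 0).map
      (constToPush (unionOpen U Finset.univ).inclusion') ≫
    mapFromSingle (push (unionOpen U Finset.univ).inclusion') (S.res Finset.univ).ι'

lemma zeroPart_coaugmentation : zeroPart (coaugmentation S) =
    constToPush (unionOpen U Finset.univ).inclusion' ≫ augmentation (S.res Finset.univ) :=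
  (zeroPart_single_map_comp _ _).trans (congrArg (_ ≫ ·) (zeroPart_mapFromSingle _ _))

lemma unionOpen_univ (hU : ⨆ k, U k = ⊤) : unionOpen U Finset.univ = ⊤ := by
  simp [unionOpen, hU]

lemma quasiIso_coaugmentation (hU : ⨆ k, U k = ⊤) : QuasiIso (coaugmentation S) := by
  have := isIso_constToPush_of_eq_top (unionOpen_univ hU)
  have := isEquivalence_push_of_eq_top (unionOpen_univ hU)
  have : QuasiIso (mapFromSingle (push (unionOpen U Finset.univ).inclusion')
    (S.res Finset.univ).ι') := quasiIso_mapFromSingle _ _ (quasiIso_injectiveResolution _)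
  rw [coaugmentation]
  infer_instance

/-- The morphism from the restriction of the global resolution to the resolution over `U_A`. -/
def compare (A : Finset (Fin r)) :
    restrComplex (unionOpen U A) S.global ⟶ (S.res A).cochainComplex :=
  transpose (S.restrict (Finset.subset_univ A))

lemma mapFromSingle_coaugmentation_comp_compare (A : Finset (Fin r)) :
    mapFromSingle (restr (unionOpen U A)) (coaugmentation S) ≫ compare S A =
      (HomologicalComplex.single _ (ComplexShape.up ℤ) 0).map
        (((restrAdj (unionOpen U A)).homEquiv _ _).symm
          (constToPush (unionOpen U A).inclusion')) ≫ (S.res A).ι' := by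
  apply zeroPart_injective
  have h : zeroPart (coaugmentation S) ≫ (S.restrict (Finset.subset_univ A)).f 0 =
      constToPush (unionOpen U A).inclusion' ≫ augmentation (S.res A) := by
    refine (congrArg (· ≫ _) (zeroPart_coaugmentation S)).trans ((Category.assoc _ _ _).trans ?_)
    refine (congrArg (_ ≫ ·) (S.augmentation_restrict (Finset.subset_univ A))).trans ?_
    exact (Category.assoc _ _ _).symm.trans
      (congrArg (· ≫ _) (constToPush_constRestrict (unionOpen_mono U (Finset.subset_univ A))))
  refine (zeroPart_comp _ _).trans ((congrArg (· ≫ (compare S A).f 0)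
    (zeroPart_mapFromSingle _ _)).trans ?_)
  refine Eq.trans ?_ (zeroPart_single_map_comp _ _).symm
  exact ((restrAdj (unionOpen U A)).homEquiv_naturality_left_symm _ _).symm.trans
    ((congrArg ((restrAdj (unionOpen U A)).homEquiv _ _).symm h).trans
      ((restrAdj (unionOpen U A)).homEquiv_naturality_right_symm _ _))

lemma quasiIso_compare (hU : ⨆ k, U k = ⊤) (A : Finset (Fin r)) : QuasiIso (compare S A) := by
  have := isIso_homEquiv_symm_constToPush _ (restrAdj (unionOpen U A))
  exact quasiIso_of_comp_eq_single _ _ _ _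
    (quasiIso_mapFromSingle _ _ (quasiIso_coaugmentation S hU)) (quasiIso_injectiveResolution _)
    (mapFromSingle_coaugmentation_comp_compare S A)

/-- The restriction of the global resolution to an open subspace is quasi-isomorphic to any
injective resolution of the constant sheaf there. -/
lemma exists_quasiIso_restrComplex (hU : ⨆ k, U k = ⊤) (W : Opens X)
    (K : InjectiveResolution (constSheaf ((Opens.toTopCat X).obj W))) :
    ∃ φ : restrComplex W S.global ⟶ K.cochainComplex, QuasiIso φ := by
  have := isIso_homEquiv_symm_constToPush _ (restrAdj W)
  have := quasiIso_injectiveResolution K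
  exact CochainComplex.exists_quasiIso_of_isKInjective
    (mapFromSingle (restr W) (coaugmentation S))
    ((HomologicalComplex.single _ (ComplexShape.up ℤ) 0).map
      (((restrAdj W).homEquiv _ _).symm (constToPush W.inclusion')) ≫ K.ι')
    (quasiIso_mapFromSingle _ _ (quasiIso_coaugmentation S hU)) (quasiIso_comp _ _)

end Resolution

section Cover

variable {r : ℕ} (U : Fin r → Opens X)

/-- The open set at the vertex `J` of the cube: the union of the `U_k` with `k ∉ J` if `J` is a
proper subset, and the intersection of all `U_k` at the last vertex. -/
def vertexOpen (J : Finset (Fin r)) : Opens X :=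
  if J = Finset.univ then deepest U else unionOpen U Jᶜ

lemma vertexOpen_univ : vertexOpen U Finset.univ = deepest U := if_pos rfl

lemma vertexOpen_of_ne {J : Finset (Fin r)} (h : J ≠ Finset.univ) :
    vertexOpen U J = unionOpen U Jᶜ := if_neg h

lemma mem_unionOpen {A : Finset (Fin r)} {x : X} : x ∈ unionOpen U A ↔ ∃ k ∈ A, x ∈ U k := by
  simp [unionOpen]

lemma mem_deepest {x : X} : x ∈ deepest U ↔ ∀ k, x ∈ U k := by
  rw [← SetLike.mem_coe, deepest, Opens.coe_iInf, Set.mem_iInter]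
  rfl

lemma unionOpen_compl_le_vertexOpen (J : Finset (Fin r)) : unionOpen U Jᶜ ≤ vertexOpen U J := by
  by_cases h : J = Finset.univ
  · subst h
    intro x hx
    obtain ⟨k, hk, _⟩ := (mem_unionOpen U).mp hx
    simp at hk
  · exact (vertexOpen_of_ne U h).ge

lemma vertexOpen_antitone : Antitone (vertexOpen U) := by
  intro J J' hJ x hx
  by_cases h : J = Finset.univ
  · subst h
    rwa [Finset.univ_subset_iff.mp hJ] at hx
  · rw [vertexOpen_of_ne U h, mem_unionOpen]
    by_cases h' : J' = Finset.univ
    · subst h'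
      rw [vertexOpen_univ, mem_deepest] at hx
      obtain ⟨k, hk⟩ : Jᶜ.Nonempty := Finset.nonempty_iff_ne_empty.mpr
        fun h'' => h ((Finset.compl_eq_empty_iff J).mp h'')
      exact ⟨k, hk, hx k⟩
    · rw [vertexOpen_of_ne U h', mem_unionOpen] at hx
      obtain ⟨k, hk, hk'⟩ := hx
      exact ⟨k, Finset.compl_subset_compl.mpr hJ hk, hk'⟩

open Classical in
/-- An index `k` with `x ∉ U_k` if there is one, and the index `k₀` otherwise. -/
def vertexAt (k₀ : Fin r) (x : X) : Fin r := if h : ∃ k, x ∉ U k then h.choose else k₀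

/-- Adding `k` with `x ∉ U_k` to `J` does not remove `x` from the union of the `U_i` with `i ∉ J`,
and `x` lies in all open sets of the cube if there is no such `k`. -/
lemma mem_vertexOpen_insert (k₀ : Fin r) (x : X) (J : Finset (Fin r)) (hx : x ∈ vertexOpen U J)
    (hJ : vertexAt U k₀ x ∉ J) : x ∈ vertexOpen U (insert (vertexAt U k₀ x) J) := by
  by_cases h : ∃ k, x ∉ U k
  · have hk : x ∉ U (vertexAt U k₀ x) := by
      rw [vertexAt, dif_pos h]
      exact h.choose_spec
    have hne : J ≠ Finset.univ := fun h' => hJ (h' ▸ Finset.mem_univ _)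
    rw [vertexOpen_of_ne U hne, mem_unionOpen] at hx
    obtain ⟨i, hi, hi'⟩ := hx
    apply unionOpen_compl_le_vertexOpen
    rw [mem_unionOpen]
    refine ⟨i, ?_, hi'⟩
    rw [Finset.mem_compl, Finset.mem_insert]
    rintro (rfl | h')
    · exact hk hi'
    · exact Finset.mem_compl.mp hi h'
  · push Not at h
    exact vertexOpen_antitone U (Finset.subset_univ _)
      ((vertexOpen_univ U).symm ▸ (mem_deepest U).mpr h)

end Cover

end CechComplement

/-! ### The double complex of a cover -/

namespace CategoryTheory.Limits.biproduct

variable {C : Type*} [Category* C] [Preadditive C] [HasFiniteBiproducts C]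
  {ι κ : Type} [Finite ι] [Finite κ]

lemma matrix_comp_map {F F' : ι → C} {G G' : κ → C} {m : ∀ i k, F i ⟶ G k}
    {m' : ∀ i k, F' i ⟶ G' k} {f : ∀ i, F i ⟶ F' i} {g : ∀ k, G k ⟶ G' k}
    (h : ∀ i k, m i k ≫ g k = f i ≫ m' i k) :
    biproduct.matrix m ≫ biproduct.map g = biproduct.map f ≫ biproduct.matrix m' := by
  apply biproduct.hom_ext'
  intro i
  apply biproduct.hom_ext
  intro k
  simp [h]

lemma isIso_functor_map_map {D : Type*} [Category* D] [Preadditive D] (T : C ⥤ D) [T.Additive]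
    {F F' : ι → C} (f : ∀ i, F i ⟶ F' i) (hf : ∀ i, IsIso (T.map (f i))) :
    IsIso (T.map (biproduct.map f)) := by
  have := Fintype.ofFinite ι
  refine ⟨∑ i, T.map (biproduct.π F' i) ≫ inv (T.map (f i)) ≫ T.map (biproduct.ι F i), ?_, ?_⟩
  · rw [Preadditive.comp_sum, ← T.map_id, ← biproduct.total, T.map_sum]
    refine Finset.sum_congr rfl fun i _ => ?_
    rw [← T.map_comp_assoc, biproduct.map_π, T.map_comp_assoc, IsIso.hom_inv_id_assoc, T.map_comp]
  · rw [Preadditive.sum_comp, ← T.map_id, ← biproduct.total, T.map_sum]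
    refine Finset.sum_congr rfl fun i _ => ?_
    rw [Category.assoc, Category.assoc, ← T.map_comp, biproduct.ι_map, T.map_comp,
      IsIso.inv_hom_id_assoc, T.map_comp]

end CategoryTheory.Limits.biproduct

lemma CochainComplex.isZero_biproduct_X {C : Type*} [Category* C] [Abelian C]
    [HasFiniteBiproducts (CochainComplex C ℤ)] {ι : Type} [Finite ι]
    {F : ι → CochainComplex C ℤ} {q : ℤ} (h : ∀ i, IsZero ((F i).X q)) :
    IsZero ((⨁ F).X q) := by
  have := Fintype.ofFinite ι
  let T := HomologicalComplex.eval C (ComplexShape.up ℤ) q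
  rw [IsZero.iff_id_eq_zero]
  refine (T.map_id (⨁ F)).symm.trans ?_
  rw [← biproduct.total, T.map_sum]
  refine Finset.sum_eq_zero fun i _ => ?_
  rw [T.map_comp]
  exact ((h i).eq_of_tgt _ 0 =≫ _).trans zero_comp

/-- Homology is additive, hence a finite biproduct of quasi-isomorphisms is a
quasi-isomorphism. -/
lemma CochainComplex.quasiIso_biproduct_map {C : Type*} [Category* C] [Abelian C]
    [HasFiniteBiproducts (CochainComplex C ℤ)] {ι : Type} [Finite ι]
    {F F' : ι → CochainComplex C ℤ} (f : ∀ i, F i ⟶ F' i) (hf : ∀ i, QuasiIso (f i)) :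
    QuasiIso (biproduct.map f) := by
  rw [quasiIso_iff]
  intro n
  rw [quasiIsoAt_iff_isIso_homologyMap]
  exact biproduct.isIso_functor_map_map
    (HomologicalComplex.homologyFunctor C (ComplexShape.up ℤ) n) f fun i =>
      (quasiIsoAt_iff_isIso_homologyMap _ _).mp ((quasiIso_iff _).mp (hf i) n)

namespace CechComplement

variable {X : TopCat.{u}} {r : ℕ} {U : Fin r → Opens X} (S : ResolutionSystem U)

/-- The cube of the complexes `j_* j^*` of the global resolution, where `j` is the inclusion of the
open set at a vertex. -/
def resolutionCube : Finset (Fin r) ⥤ CochainComplex (Sh X) ℤ where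
  obj J := locComplex (vertexOpen U J) S.global
  map f := locComplexMap (vertexOpen_antitone U f.le) S.global
  map_id _ := locComplexMap_refl _ _
  map_comp _ _ := (locComplexMap_comp _ _ _).symm

lemma isZero_resolutionCube (J : Finset (Fin r)) (q : ℤ) (hq : q < 0) :
    IsZero (((resolutionCube S).obj J).X q) :=
  (loc (vertexOpen U J)).map_isZero (CochainComplex.isZero_of_isStrictlyGE S.global 0 q hq)

lemma nonempty_resolutionCubeContraction (k₀ : Fin r) (q : ℤ) :
    Nonempty (CubeContraction (degreeCube (C := Sh X) (resolutionCube S) q)) :=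
  nonempty_locCubeContraction (vertexOpen U) (vertexOpen_antitone U) (vertexAt U k₀)
    (mem_vertexOpen_insert U k₀) (S.global.X q)

/-- The comparison of the vertex `J` of the cube with the summand of the double complex. -/
def toSummand (J : Finset (Fin r)) : (resolutionCube S).obj J ⟶ S.summand J :=
  locComplexMap (unionOpen_compl_le_vertexOpen U J) S.global ≫
    (pushComplex (unionOpen U Jᶜ).inclusion').map (compare S Jᶜ)

lemma map_comp_toSummand {J J' : Finset (Fin r)} (h : J ⊆ J') :
    (resolutionCube S).map (homOfLE h) ≫ toSummand S J' =
      toSummand S J ≫ S.restrict (Finset.compl_subset_compl.mpr h) := by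
  have h' := unionOpen_mono U (Finset.compl_subset_compl.mpr h)
  refine (Category.assoc _ _ _).symm.trans ((congrArg (· ≫ _) ((locComplexMap_comp _ _ _).trans
    (locComplexMap_comp h' (unionOpen_compl_le_vertexOpen U J) _).symm)).trans ?_)
  refine (Category.assoc _ _ _).trans (Eq.trans ?_ (Category.assoc _ _ _).symm)
  exact congrArg (_ ≫ ·) (pushComplex_map_transpose_comp h' _ _ _ (S.restrict_comp _ _)).symm

lemma quasiIso_toSummand (hU : ⨆ k, U k = ⊤) {J : Finset (Fin r)} (hJ : J ≠ Finset.univ) :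
    QuasiIso (toSummand S J) :=
  quasiIso_locComplexMap_comp _ (vertexOpen_of_ne U hJ).le _ (quasiIso_compare S hU Jᶜ)

lemma cubeEntry_comp_toSummand {J J' : Finset (Fin r)} (h : J'.card = J.card + 1) :
    cubeEntry (resolutionCube S) J J' ≫ toSummand S J' = toSummand S J ≫ S.entry J J' := by
  by_cases hJ : J ⊆ J'
  · rw [cubeEntry_of_le _ hJ, ResolutionSystem.entry, dif_pos hJ, incidence, if_pos ⟨hJ, h⟩,
      Preadditive.zsmul_comp, Preadditive.comp_zsmul, map_comp_toSummand]
  · rw [cubeEntry, dif_neg hJ, ResolutionSystem.entry, dif_neg hJ, zero_comp, comp_zero]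

/-- The sum of the comparison morphisms over the vertices with `p` elements. -/
def toTerm (p : ℤ) : (⨁ fun J : Idx r p => (resolutionCube S).obj J.1) ⟶ S.term p :=
  biproduct.map fun J : Idx r p => toSummand S J.1

lemma matrix_comp_toTerm {p q : ℤ} (hpq : p + 1 = q) :
    biproduct.matrix (fun (J : Idx r p) (J' : Idx r q) =>
      cubeEntry (resolutionCube S) J.1 J'.1) ≫ toTerm S q = toTerm S p ≫ S.diff p q := by
  rw [ResolutionSystem.diff, if_pos hpq]
  have h (J : Idx r p) (J' : Idx r q) : cubeEntry (resolutionCube S) J.1 J'.1 ≫ toSummand S J'.1 =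
      toSummand S J.1 ≫ S.entry J.1 J'.1 :=
    cubeEntry_comp_toSummand S (by have := J.2.1; have := J'.2.1; omega)
  exact biproduct.matrix_comp_map (f := fun J : Idx r p => toSummand S J.1)
    (g := fun J' : Idx r q => toSummand S J'.1) (m' := fun J J' => S.entry J.1 J'.1) h

/-- The morphism of double complexes given by the comparison morphisms of the summands. -/
def toDoubleComplex : cubeComplex (resolutionCube S) ⟶ S.doubleComplex where
  f p := toTerm S p
  comm' p q (hpq : p + 1 = q) :=
    ((congrArg (· ≫ toTerm S q) (cubeComplex_d _ hpq)).trans (matrix_comp_toTerm S hpq)).symm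

lemma isFirstQuadrant_doubleComplex : S.doubleComplex.IsFirstQuadrant := by
  rintro p q (hp | hq)
  · exact CochainComplex.isZero_biproduct_X fun J : Idx r p => by
      have := J.2.1
      omega
  · exact CochainComplex.isZero_biproduct_X fun J : Idx r p =>
      CochainComplex.isZero_of_isStrictlyGE (S.summand J.1) 0 q hq

/-- The intersection of all `U_k` is the open set at the last vertex of the cube. -/
lemma exists_quasiIso_resolutionCube_univ (hU : ⨆ k, U k = ⊤)
    (K : InjectiveResolution (constSheaf ((Opens.toTopCat X).obj (deepest U)))) :
    ∃ φ : (resolutionCube S).obj Finset.univ ⟶ derivedPush K, QuasiIso φ := by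
  obtain ⟨φ, hφ⟩ := exists_quasiIso_restrComplex S hU (deepest U) K
  exact ⟨_, quasiIso_locComplexMap_comp (vertexOpen_univ U).ge (vertexOpen_univ U).le φ hφ⟩

instance {W : Opens X} (R : InjectiveResolution (constSheaf ((Opens.toTopCat X).obj W))) :
    (derivedPush R).IsKInjective :=
  have (n : ℤ) : Injective ((derivedPush R).X n) := injective_push W (R.cochainComplex.X n)
  CochainComplex.isKInjective_of_injective _ 0

end CechComplement

end

theorem mainTheorem3 (X : TopCat.{u}) [LocallyCompactSpace X] [T2Space X] (r : ℕ) (hr : 1 ≤ r)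
    (U : Fin r → Opens X) (hU : ⨆ k, U k = ⊤)
    (S : CechComplement.ResolutionSystem U)
    (K : InjectiveResolution (CechComplement.constSheaf
      ((Opens.toTopCat X).obj (CechComplement.deepest U)))) :
    ∃ φ : S.total ⟶
        (shiftFunctor (CochainComplex (CechComplement.Sh X) ℤ) (-((r : ℤ) - 1))).obj
          (CechComplement.derivedPush K),
      QuasiIso φ := by
  have : HomologicalComplex₂.HasTotal
      (CechComplement.cubeComplex (CechComplement.resolutionCube S)) (ComplexShape.up ℤ) :=
    fun _ => inferInstance
  obtain ⟨ψ, hψ⟩ := CechComplement.exists_quasiIso_resolutionCube_univ S hU K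
  have h₁ := CechComplement.quasiIso_totalToShift_cubeAugmentation (N := (r : ℤ) - 1) (by omega)
    (CechComplement.isZero_resolutionCube S)
    (fun q => (CechComplement.nonempty_resolutionCubeContraction S ⟨0, hr⟩ q).some)
  have h₂ := HomologicalComplex₂.quasiIso_total_map
    (CechComplement.isFirstQuadrant_cubeComplex (CechComplement.isZero_resolutionCube S))
    (CechComplement.isFirstQuadrant_doubleComplex S) (CechComplement.toDoubleComplex S) fun p =>
      CochainComplex.quasiIso_biproduct_map _ fun J => CechComplement.quasiIso_toSummand S hU J.2.2
  have h₃ : QuasiIso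
      ((shiftFunctor (CochainComplex (CechComplement.Sh X) ℤ) (-((r : ℤ) - 1))).map ψ) :=
    inferInstance
  -- The comparison of double complexes points towards `S.total`; it is inverted up to homotopy,
  -- as the target is K-injective.
  exact CochainComplex.exists_quasiIso_of_isKInjective _
    (HomologicalComplex₂.totalToShift _ _ _ ≫ (shiftFunctor _ _).map ψ) h₂
    (@quasiIso_comp _ _ _ _ _ _ _ _ _ _ _ _ _ h₁ h₃)
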